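/- Consider signatures consisting of a set $\tau_0$ of unary symbols, the four navigational binary symbols ${\downarrow},{\downarrow^+},{\rightarrow},{\rightarrow^+}$, and a set $\tau_{com}$ of further (uninterpreted) binary symbols. Formulas are interpreted over finite nonempty unranked ordered trees, where ${\downarrow}$ is the child relation, ${\rightarrow}$ the right-sibling relation, and ${\downarrow^+},{\rightarrow^+}$ are their transitive closures. The ten order formulas are $x{\downarrow}y$, $y{\downarrow}x$, $x{\downarrow^+}y\wedge\neg x{\downarrow}y$, $y{\downarrow^+}x\wedge\neg y{\downarrow}x$, $x{\rightarrow}y$, $y{\rightarrow}x$, $x{\rightarrow^+}y\wedge\neg x{\rightarrow}y$, $y{\rightarrow^+}x\wedge\neg y{\rightarrow}x$, $x=y$, and "$x\neq y$ and $x,y$ are related by no navigational symbol". A formula $\varphi$ of $\mathrm{FO}^2[{\downarrow},{\downarrow^+},{\rightarrow},{\rightarrow^+},\tau_{com}]$ is in normal form if $$\varphi=\forall x\forall y\,\chi(x,y)\wedge\bigwedge_{i=1}^m\forall x\bigl(A_i(x)\Rightarrow\exists y(\theta_i(x,y)\wedge\chi_i(x,y))\bigr),$$ where the $A_i$ are unary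 symbols, the $\theta_i$ are order formulas, and $\chi,\chi_i$ are quantifier-free (equality is allowed). A $1$-type of $\varphi$ is a maximal satisfiable (at some node of some finite tree) set of atoms and negated atoms in the single variable $x$ over the symbols appearing in $\varphi$; let $\boldsymbol\alpha_\varphi$ be the set of these, and put $\mathfrak f(\varphi)=96\,m^3|\boldsymbol\alpha_\varphi|^3$. **Theorem.** The number $\mathfrak f(\varphi)$ is at most exponential in the size $|\varphi|$ of $\varphi$: there is a constant $c$ with $\mathfrak f(\varphi)\le 2^{c|\varphi|}$ for all normal form formulas $\varphi$. Every normal form formula $\varphi$ that is satisfied in some finite tree has a finite tree model in which every node has at most $\mathfrak f(\varphi)$ children and, provided $m\ge 1$, every ${\downarrow}$-path (sequence of nodes $v_1,\dots,v_k$ with $v_i{\downarrow}v_{i+1}$) has length, counted as its number $k$ of nodes, at most $\mathfrak f(\varphi)$. -/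

import Mathlib

open FirstOrder FirstOrder.Language

namespace TreeFO2

universe u v

/-- The navigational binary symbols: child, descendant, right sibling, following sibling. -/
inductive Nav : Type
  | child
  | desc
  | next
  | foll

/-- The relation symbols of a tree signature: unary symbols from `U`, the four navigational
binary symbols, and common (uninterpreted) binary symbols from `C`. -/
inductive TreeRel (U : Type u) (C : Type v) : ℕ → Type (max u v)
  | unary (A : U) : TreeRel U C 1
  | nav (N : Nav) : TreeRel U C 2
  | common (R : C) : TreeRel U C 2

/-- The relational first-order language of a tree signature. -/
def treeLang (U : Type u) (C : Type v) : FirstOrder.Language.{0, max u v} :=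
  ⟨fun _ => Empty, TreeRel U C⟩

section Trees

/-- `child` and `next` are the child relation and the right-sibling relation of an unranked
ordered tree (a node has arbitrarily many children, and they are linearly ordered from
left to right, `next` being the successor relation of this order). -/
structure IsOrderedTree {T : Type} (child next : T → T → Prop) : Prop where
  /-- There is a root: a node without a parent, from which every node can be reached. -/
  exists_root : ∃ r : T, (∀ p, ¬ child p r) ∧ ∀ w, Relation.ReflTransGen child r w
  /-- A node has at most one parent. -/
  parent_unique : ∀ p q w, child p w → child q w → p = q
  /-- Only nodes with a common parent are related by `next`. -/
  next_siblings : ∀ a b, next a b → ∃ p, child p a ∧ child p b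
  /-- A node has at most one right sibling. -/
  next_unique : ∀ a b c, next a b → next a c → b = c
  /-- The sibling order is irreflexive. -/
  foll_irrefl : ∀ a, ¬ Relation.TransGen next a a
  /-- The sibling order is total on the children of a node. -/
  foll_total : ∀ p a b, child p a → child p b →
    a = b ∨ Relation.TransGen next a b ∨ Relation.TransGen next b a

/-- A finite tree structure over the signature with unary symbols `U` and common binary
symbols `C`. -/
structure TreeStructure (U : Type u) (C : Type v) where
  /-- The universe of the tree. -/
  Carrier : Type
  finite : Finite Carrier
  /-- The child relation. -/
  child : Carrier → Carrier → Prop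
  /-- The right-sibling relation. -/
  next : Carrier → Carrier → Prop
  isTree : IsOrderedTree child next
  /-- The interpretation of the unary symbols. -/
  unary : U → Carrier → Prop
  /-- The interpretation of the common binary symbols. -/
  common : C → Carrier → Carrier → Prop

variable {U : Type u} {C : Type v}

/-- The interpretation of the navigational symbols in a tree. -/
def TreeStructure.nav (T : TreeStructure U C) : Nav → T.Carrier → T.Carrier → Prop
  | .child => T.child
  | .desc => Relation.TransGen T.child
  | .next => T.next
  | .foll => Relation.TransGen T.next

/-- The interpretation of all relation symbols in a tree. -/
def TreeStructure.relMap (T : TreeStructure U C) :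
    ∀ {n : ℕ}, TreeRel U C n → (Fin n → T.Carrier) → Prop
  | _, .unary A, a => T.unary A (a 0)
  | _, .nav N, a => T.nav N (a 0) (a 1)
  | _, .common R, a => T.common R (a 0) (a 1)

/-- A tree is a first-order structure over the language of its signature. -/
instance (T : TreeStructure U C) : (treeLang U C).Structure T.Carrier where
  funMap := fun f => Empty.elim f
  RelMap := fun R a => T.relMap R a

/-- The number of children of a node. -/
noncomputable def TreeStructure.degree (T : TreeStructure U C) (a : T.Carrier) : ℕ :=
  Set.ncard {b | T.child a b}

/-- A `↓`-path: a sequence of nodes in which each node is a child of its predecessor.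
Its length is the number of its nodes. -/
def TreeStructure.IsDownPath (T : TreeStructure U C) (P : List T.Carrier) : Prop :=
  P.IsChain T.child

end Trees

section Formulas

variable {U : Type u} {C : Type v}

/-- A sentence is satisfiable if it is true in some finite tree. -/
def Satisfiable (ψ : (treeLang U C).Sentence) : Prop :=
  ∃ T : TreeStructure U C, T.Carrier ⊨ ψ

/-- The relation symbols appearing in a formula. -/
def symbols {α : Type} :
    ∀ {n : ℕ}, (treeLang U C).BoundedFormula α n → Set (Σ k, TreeRel U C k)
  | _, .falsum => ∅
  | _, .equal _ _ => ∅
  | _, .rel (l := l) R _ => {⟨l, R⟩}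
  | _, .imp f g => symbols f ∪ symbols g
  | _, .all f => symbols f

/-- The size of a formula: the number of occurrences of symbols in it (relation symbols,
equality signs, variables, connectives and quantifiers). -/
def size {α : Type} : ∀ {n : ℕ}, (treeLang U C).BoundedFormula α n → ℕ
  | _, .falsum => 1
  | _, .equal _ _ => 3
  | _, .rel (l := l) _ _ => l + 1
  | _, .imp f g => size f + size g + 1
  | _, .all f => size f + 2

/-- In formulas with two variables, the variable `x` is `&0` and the variable `y` is `&1`.
`xNy N` is the atom `N(x,y)` for a navigational symbol `N`. -/
def xNy (N : Nav) : (treeLang U C).BoundedFormula Empty 2 :=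
  Relations.boundedFormula₂ (L := treeLang U C) (TreeRel.nav N) (&0) (&1)

/-- The atom `N(y,x)` for a navigational symbol `N`. -/
def yNx (N : Nav) : (treeLang U C).BoundedFormula Empty 2 :=
  Relations.boundedFormula₂ (L := treeLang U C) (TreeRel.nav N) (&1) (&0)

/-- The equality atom `x = y`. -/
def xEqy : (treeLang U C).BoundedFormula Empty 2 :=
  Term.bdEqual (&0) (&1)

/-- The ten order formulas, specifying the relative position of `x` and `y`. -/
inductive OrderFormula : Type
  | down
  | up
  | downDown
  | upUp
  | right
  | left
  | rightRight
  | leftLeft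
  | free
  | eq

/-- The formulas which the ten order formulas stand for. -/
def OrderFormula.toFormula : OrderFormula → (treeLang U C).BoundedFormula Empty 2
  | .down => xNy .child
  | .up => yNx .child
  | .downDown => xNy .desc ⊓ ∼(xNy .child)
  | .upUp => yNx .desc ⊓ ∼(yNx .child)
  | .right => xNy .next
  | .left => yNx .next
  | .rightRight => xNy .foll ⊓ ∼(xNy .next)
  | .leftLeft => yNx .foll ⊓ ∼(yNx .next)
  | .free => ∼xEqy ⊓ ∼(xNy .child) ⊓ ∼(yNx .child) ⊓ ∼(xNy .desc) ⊓ ∼(yNx .desc)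
      ⊓ ∼(xNy .next) ⊓ ∼(yNx .next) ⊓ ∼(xNy .foll) ⊓ ∼(yNx .foll)
  | .eq => xEqy

/-- The data of a `∀∃`-conjunct `∀ x (A(x) → ∃ y (θ(x,y) ∧ χ(x,y)))`, where `A` is a unary
symbol, `θ` is an order formula and `χ` is quantifier-free. -/
structure Conjunct (U : Type u) (C : Type v) where
  /-- The unary symbol `A`. -/
  guard : U
  /-- The order formula `θ`. -/
  position : OrderFormula
  /-- The formula `χ`. -/
  matrix : (treeLang U C).BoundedFormula Empty 2
  isQF : matrix.IsQF

/-- The sentence `∀ x (A(x) → ∃ y (θ(x,y) ∧ χ(x,y)))`. -/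
def Conjunct.toSentence (c : Conjunct U C) : (treeLang U C).Sentence :=
  ∀' (Relations.boundedFormula₁ (L := treeLang U C) (TreeRel.unary c.guard) (&0) ⟹
    ∃' (c.position.toFormula ⊓ c.matrix))

/-- A normal form formula
`∀ x y χ(x,y) ∧ ⋀ i, ∀ x (A_i(x) → ∃ y (θ_i(x,y) ∧ χ_i(x,y)))`. -/
structure NormalForm (U : Type u) (C : Type v) where
  /-- The formula `χ`. -/
  matrix : (treeLang U C).BoundedFormula Empty 2
  isQF : matrix.IsQF
  /-- The `∀∃`-conjuncts. -/
  conjuncts : List (Conjunct U C)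

/-- The normal form formula as a first-order sentence. -/
def NormalForm.toSentence (φ : NormalForm U C) : (treeLang U C).Sentence :=
  φ.conjuncts.foldl (fun ψ c => ψ ⊓ c.toSentence) (∀' ∀' φ.matrix)

/-- The number `m` of `∀∃`-conjuncts. -/
def NormalForm.m (φ : NormalForm U C) : ℕ := φ.conjuncts.length

/-- `Γ` is a set of atoms and negated atoms in the single free variable `x` over the
signature consisting of the symbols appearing in `ψ`. -/
def IsLiteralSet (ψ : (treeLang U C).Sentence)
    (Γ : Set ((treeLang U C).BoundedFormula Empty 1)) : Prop :=
  ∀ γ ∈ Γ, (γ.IsAtomic ∨ ∃ δ : (treeLang U C).BoundedFormula Empty 1, δ.IsAtomic ∧ γ = ∼δ) ∧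
    symbols γ ⊆ symbols ψ

/-- A set of formulas in the single free variable `x` is satisfiable if some node of some
finite tree satisfies all of them. -/
def IsSatisfiableSet (Γ : Set ((treeLang U C).BoundedFormula Empty 1)) : Prop :=
  ∃ (T : TreeStructure U C) (a : T.Carrier), ∀ γ ∈ Γ, γ.Realize Empty.elim ![a]

/-- The set `α_ψ` of (atomic) `1`-types over the signature of `ψ`: the maximal satisfiable
sets of atoms and negated atoms in the single free variable `x`. -/
def oneTypes (ψ : (treeLang U C).Sentence) :
    Set (Set ((treeLang U C).BoundedFormula Empty 1)) :=
  {Γ | Maximal (fun Δ => IsLiteralSet ψ Δ ∧ IsSatisfiableSet Δ) Γ}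

/-- The bound `f(φ) = 96 m³ |α_φ|³`. -/
noncomputable def NormalForm.bound (φ : NormalForm U C) : ℕ :=
  96 * φ.m ^ 3 * (oneTypes φ.toSentence).ncard ^ 3

end Formulas

end TreeFO2

/-! The size estimate holds because a 1-type is determined by the symbols of `φ` that hold at a node
with all arguments equal to it, so there are at most `2 ^ size` types.

For the model, take one with the fewest nodes (if `m = 0`, a single node suffices). A downward path
or a row of siblings longer than the bound would allow a contraction to a smaller model. Both cases
share one abstraction, `IsSpine`: spine nodes `c 1, …, c d` cut the tree into segments numbered by
`rank`, and up to exceptions next to the spine, the position of a node relative to another segment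
depends only on whether that segment comes before or after its own and on whether the target is a
spine node.

Write `n` for the number of types and fix a witness for every node and conjunct. Collect a small
repository `F` that holds, for each type and each of "on" and "off" the spine, `2m` elements of
extreme rank at either end. Let `Q` be `F` with its witnesses and their witnesses. Since `Q` is
small, pigeonhole gives `i < j` such that `c i` and `c j` have equal types and no element of `Q` has
rank in `[i - 1, j]` (`exists_equal_types`). Delete the ranks `i, …, j - 1` and put `c j` in the
place of `c i`.

A surviving node `x` may lose a witness `b`. In general, `F` contains `2m` elements of the type of
`b` and in the same position relative to `x`, and the uninterpreted binary relations between `x` and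
one of them are redefined as those between `x` and `b`. Hall's theorem makes the replacements for
the different conjuncts distinct and different from the witnesses `x` already has. The choice of `Q`
ensures that no pair is redefined from both sides and that no witness of an element of `F` is
spoiled (`exists_redirect`). The exceptional witnesses next to the cut are supplied by the equality
of the types of `c i` and `c j`: `c j` serves as `c i` did, or uses the witness of `c i`
(`IsSpine.exists_contraction`).

In the result every pair of nodes copies a pair of the old model, with the same position and types,
so the universal conjunct survives as well (`NormalForm.exists_model`). -/

namespace TreeFO2

open Relation

/-! ### Elementary order theory of ordered trees. -/

namespace IsOrderedTree

variable {T : Type} {child next : T → T → Prop}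

/-- Parents being unique, a cycle through a node also passes through its parent; moving upwards, it
would reach the root, which has no parent. -/
theorem desc_irrefl (h : IsOrderedTree child next) (a : T) : ¬ TransGen child a a := by
  obtain ⟨r, hr, hreach⟩ := h.exists_root
  induction hreach a with
  | refl =>
    intro hc
    obtain ⟨b, -, hb⟩ := TransGen.tail'_iff.1 hc
    exact hr b hb
  | @tail w x _ hwx ih =>
    intro hc
    obtain ⟨y, hxy, hyx⟩ := TransGen.tail'_iff.1 hc
    obtain rfl := h.parent_unique _ _ _ hyx hwx
    exact ih (TransGen.head' hwx hxy)

theorem le_antisymm (h : IsOrderedTree child next) {a b : T} (hab : ReflTransGen child a b)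
    (hba : ReflTransGen child b a) : a = b := by
  rcases reflTransGen_iff_eq_or_transGen.1 hab with e | hab
  · exact e.symm
  · exact absurd (hab.trans_left hba) (h.desc_irrefl a)

theorem le_parent (h : IsOrderedTree child next) {a p b : T} (hab : ReflTransGen child a b)
    (hpb : child p b) (hne : b ≠ a) : ReflTransGen child a p := by
  rcases ReflTransGen.cases_tail hab with e | ⟨q, haq, hqb⟩
  · exact absurd e hne
  · rwa [h.parent_unique _ _ _ hpb hqb]

theorem le_total_of_le (h : IsOrderedTree child next) {a b x : T} (hax : ReflTransGen child a x)
    (hbx : ReflTransGen child b x) : ReflTransGen child a b ∨ ReflTransGen child b a := by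
  induction hax with
  | refl => exact Or.inr hbx
  | @tail y x hay hyx ih =>
    by_cases hxb : x = b
    · subst hxb; exact Or.inl (hay.tail hyx)
    · exact ih (h.le_parent hbx hyx hxb)

theorem foll_siblings (h : IsOrderedTree child next) {a b : T} (hab : TransGen next a b) :
    ∃ p, child p a ∧ child p b := by
  induction hab with
  | single hab => exact h.next_siblings _ _ hab
  | tail _ hbc ih =>
    obtain ⟨p, hpa, hpb⟩ := ih
    obtain ⟨q, hqb, hqc⟩ := h.next_siblings _ _ hbc
    obtain rfl := h.parent_unique _ _ _ hpb hqb
    exact ⟨p, hpa, hqc⟩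

theorem child_of_foll (h : IsOrderedTree child next) {a b p : T} (hab : TransGen next a b)
    (hp : child p a) : child p b := by
  obtain ⟨q, hqa, hqb⟩ := h.foll_siblings hab
  rwa [h.parent_unique _ _ _ hp hqa]

theorem child_of_foll' (h : IsOrderedTree child next) {a b p : T} (hab : TransGen next a b)
    (hp : child p b) : child p a := by
  obtain ⟨q, hqa, hqb⟩ := h.foll_siblings hab
  rwa [h.parent_unique _ _ _ hp hqb]

theorem not_foll_of_desc (h : IsOrderedTree child next) {a b : T} (hab : TransGen child a b) :
    ¬ TransGen next a b ∧ ¬ TransGen next b a := by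
  have key : ∀ p, child p a → child p b → False := by
    intro p hpa hpb
    obtain ⟨q, haq, hqb⟩ := TransGen.tail'_iff.1 hab
    obtain rfl := h.parent_unique _ _ _ hpb hqb
    exact h.desc_irrefl _ (TransGen.head' hpa haq)
  constructor
  · intro hf
    obtain ⟨p, hp, hp'⟩ := h.foll_siblings hf
    exact key p hp hp'
  · intro hf
    obtain ⟨p, hp, hp'⟩ := h.foll_siblings hf
    exact key p hp' hp

/-- Two left neighbours of `c` would be comparable siblings; the right neighbour of the earlier one
is `c`, so `c` would precede or equal the later one and lie on a cycle. -/
theorem next_unique_left (h : IsOrderedTree child next) {a b c : T} (hac : next a c)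
    (hbc : next b c) : a = b := by
  have key : ∀ a b, next a c → next b c → ¬ TransGen next a b := by
    intro a b hac hbc hab
    obtain ⟨z, haz, hzb⟩ := TransGen.head'_iff.1 hab
    obtain rfl := h.next_unique _ _ _ hac haz
    exact h.foll_irrefl _ (TransGen.tail' hzb hbc)
  obtain ⟨p, hpa, hpc⟩ := h.next_siblings _ _ hac
  rcases h.foll_total p a b hpa (h.child_of_foll' (.single hbc) hpc) with e | e | e
  · exact e
  · exact absurd e (key _ _ hac hbc)
  · exact absurd e (key _ _ hbc hac)

end IsOrderedTree

/-! ### Relative positions of pairs of nodes. -/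

open Classical in
/-- The relative position of two nodes. -/
noncomputable def relPos {T : Type} (child next : T → T → Prop) (a b : T) : OrderFormula :=
  if a = b then .eq
  else if child a b then .down
  else if child b a then .up
  else if TransGen child a b then .downDown
  else if TransGen child b a then .upUp
  else if next a b then .right
  else if next b a then .left
  else if TransGen next a b then .rightRight
  else if TransGen next b a then .leftLeft
  else .free

/-- The position of `y` relative to `x`, given that of `x` relative to `y`. -/
def OrderFormula.flip : OrderFormula → OrderFormula
  | .down => .up
  | .up => .down
  | .downDown => .upUp
  | .upUp => .downDown
  | .right => .left
  | .left => .right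
  | .rightRight => .leftLeft
  | .leftLeft => .rightRight
  | .free => .free
  | .eq => .eq

/-- The navigational atoms of a pair of nodes in two trees agree. -/
structure NavAgree {T T' : Type} (child next : T → T → Prop) (child' next' : T' → T' → Prop)
    (a b : T) (a' b' : T') : Prop where
  eq_iff : a = b ↔ a' = b'
  child_iff : child a b ↔ child' a' b'
  desc_iff : TransGen child a b ↔ TransGen child' a' b'
  next_iff : next a b ↔ next' a' b'
  foll_iff : TransGen next a b ↔ TransGen next' a' b'

theorem relPos_congr {T T' : Type} {child next : T → T → Prop} {child' next' : T' → T' → Prop}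
    {a b : T} {a' b' : T'} (h : NavAgree child next child' next' a b a' b')
    (h' : NavAgree child next child' next' b a b' a') :
    relPos child next a b = relPos child' next' a' b' := by
  classical
  simp only [relPos, h.eq_iff, h.child_iff, h.desc_iff, h.next_iff, h.foll_iff, h'.child_iff,
    h'.desc_iff, h'.next_iff, h'.foll_iff]

/-- The truth of an order formula at a pair of nodes. -/
def OrderFormula.Holds {T : Type} (child next : T → T → Prop) (a b : T) : OrderFormula → Prop
  | .down => child a b
  | .up => child b a
  | .downDown => TransGen child a b ∧ ¬ child a b
  | .upUp => TransGen child b a ∧ ¬ child b a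
  | .right => next a b
  | .left => next b a
  | .rightRight => TransGen next a b ∧ ¬ next a b
  | .leftLeft => TransGen next b a ∧ ¬ next b a
  | .free => a ≠ b ∧ ¬ child a b ∧ ¬ child b a ∧ ¬ TransGen child a b ∧ ¬ TransGen child b a ∧
      ¬ next a b ∧ ¬ next b a ∧ ¬ TransGen next a b ∧ ¬ TransGen next b a
  | .eq => a = b

namespace IsOrderedTree

variable {T : Type} {child next : T → T → Prop}

theorem holds_relPos (a b : T) : (relPos child next a b).Holds child next a b := by
  classical
  unfold relPos
  split_ifs <;> simp_all [OrderFormula.Holds]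

/-- In a tree the ten order formulas exclude each other, so the order of the tests in `relPos` is
immaterial. -/
theorem holds_iff (h : IsOrderedTree child next) {a b : T} {θ : OrderFormula} :
    θ.Holds child next a b ↔ relPos child next a b = θ := by
  constructor
  swap
  · rintro rfl; exact holds_relPos a b
  classical
  have e1 : ∀ a b, child a b → TransGen child a b := fun _ _ => .single
  have e2 : ∀ a b, next a b → TransGen next a b := fun _ _ => .single
  have e3 : ∀ a b, TransGen child a b → a ≠ b := fun a b hab e => h.desc_irrefl a (e ▸ hab)
  have e4 : ∀ a b, TransGen next a b → a ≠ b := fun a b hab e => h.foll_irrefl a (e ▸ hab)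
  have e5 : ∀ a b, TransGen child a b → ¬ TransGen child b a :=
    fun a b hab hba => h.desc_irrefl a (hab.trans hba)
  have e6 : ∀ a b, TransGen next a b → ¬ TransGen next b a :=
    fun a b hab hba => h.foll_irrefl a (hab.trans hba)
  have e7 : ∀ a b, TransGen child a b → ¬ TransGen next a b := fun a b hab =>
    (h.not_foll_of_desc hab).1
  have e8 : ∀ a b, TransGen child a b → ¬ TransGen next b a := fun a b hab =>
    (h.not_foll_of_desc hab).2
  have a1 := e1 a b
  have a2 := e1 b a
  have a3 := e2 a b
  have a4 := e2 b a
  have b1 := e3 a b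
  have b2 := e3 b a
  have b3 := e4 a b
  have b4 := e4 b a
  have c1 := e5 a b
  have c2 := e6 a b
  have d1 := e7 a b
  have d2 := e7 b a
  have d3 := e8 a b
  have d4 := e8 b a
  clear e1 e2 e3 e4 e5 e6 e7 e8
  have b2' : TransGen child b a → a ≠ b := fun x y => b2 x y.symm
  have b4' : TransGen next b a → a ≠ b := fun x y => b4 x y.symm
  unfold relPos
  cases θ <;> simp only [OrderFormula.Holds] <;> intro hh <;> grind

theorem relPos_self (a : T) : relPos child next a a = .eq := by
  simp [relPos]

theorem relPos_flip (h : IsOrderedTree child next) (a b : T) :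
    relPos child next b a = (relPos child next a b).flip := by
  rw [← h.holds_iff]
  have := holds_relPos (child := child) (next := next) a b
  revert this
  cases relPos child next a b <;> simp only [OrderFormula.Holds, OrderFormula.flip] <;>
    first | exact id | exact Eq.symm | tauto

/-- A position fixes every navigational atom: the transitive closures are recovered as "one step, or
more than one step". This lets the rest of the proof speak of positions only. -/
theorem navAgree_of_relPos_eq {T' : Type} {child' next' : T' → T' → Prop}
    (h : IsOrderedTree child next) (h' : IsOrderedTree child' next') {a b : T} {a' b' : T'}
    (e : relPos child next a b = relPos child' next' a' b') :
    NavAgree child next child' next' a b a' b' := by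
  have key : ∀ θ : OrderFormula, θ.Holds child next a b ↔ θ.Holds child' next' a' b' := by
    intro θ; rw [h.holds_iff, h'.holds_iff, e]
  have c := key .down
  have n := key .right
  have d := key .downDown
  have f := key .rightRight
  have e := key .eq
  simp only [OrderFormula.Holds] at c n d f e
  have aux : ∀ {p q p' q' : Prop}, (p → q) → (p' → q') → (p ↔ p') → (q ∧ ¬ p ↔ q' ∧ ¬ p') →
      (q ↔ q') := by
    clear * -
    intro p q p' q' h1 h2 h3 h4
    by_cases hp : p
    · exact ⟨fun _ => h2 (h3.1 hp), fun _ => h1 hp⟩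
    · have hp' : ¬ p' := fun h => hp (h3.2 h)
      simpa [hp, hp'] using h4
  exact ⟨e, c, aux .single .single c d, n, aux .single .single n f⟩

/-- The position of a node of a subtree, different from its root, relative to a node outside the
subtree. -/
theorem relPos_of_subtree (h : IsOrderedTree child next) {x z b : T}
    (hx : ¬ ReflTransGen child z x) (hb : ReflTransGen child z b) (hne : b ≠ z)
    [Decidable (TransGen child x z)] :
    relPos child next x b = if TransGen child x z then .downDown else .free := by
  obtain ⟨p, hzp, hpb⟩ : ∃ p, ReflTransGen child z p ∧ child p b := by
    rcases ReflTransGen.cases_tail hb with e | h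
    · exact absurd e hne
    · exact h
  have hchild : ¬ child x b := fun hc => hx (h.parent_unique _ _ _ hpb hc ▸ hzp)
  split_ifs with hd
  · rw [← h.holds_iff]
    exact ⟨hd.trans_left hb, hchild⟩
  · rw [← h.holds_iff]
    have hup : ¬ TransGen child b x := fun hc => hx (hb.trans hc.to_reflTransGen)
    have hdn : ¬ TransGen child x b := fun hc => by
      rcases h.le_total_of_le hc.to_reflTransGen hb with h1 | h1
      · rcases reflTransGen_iff_eq_or_transGen.1 h1 with e | h2
        · exact hx (e ▸ .refl)
        · exact hd h2
      · exact hx h1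
    have hf : ¬ TransGen next x b := fun hc => hx (hzp.tail (h.child_of_foll' hc hpb))
    have hf' : ¬ TransGen next b x := fun hc => hx (hzp.tail (h.child_of_foll hc hpb))
    exact ⟨fun e => hx (e ▸ hb), hchild, fun hc => hup (.single hc), hdn, hup,
      fun hc => hf (.single hc), fun hc => hf' (.single hc), hf, hf'⟩

end IsOrderedTree

/-! ### Atomic types, their number, and the transfer of models. -/

section Models

universe u v

variable {U : Type u} {C : Type v}

theorem term_eq_var {n : ℕ} (t : (treeLang U C).Term (Empty ⊕ Fin n)) :
    ∃ i, t = Term.var (Sum.inr i) := by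
  rcases t with a | ⟨f, ts⟩
  · rcases a with e | i
    · exact e.elim
    · exact ⟨i, rfl⟩
  · exact Empty.elim f

/-- The truth of a quantifier-free formula depends only on the equalities and on its symbols. -/
theorem realize_congr {T T' : TreeStructure U C} {n : ℕ}
    {ψ : (treeLang U C).BoundedFormula Empty n} (h : ψ.IsQF) {e : Empty → T.Carrier}
    {e' : Empty → T'.Carrier} {xs : Fin n → T.Carrier} {xs' : Fin n → T'.Carrier}
    (heq : ∀ i j, xs i = xs j ↔ xs' i = xs' j)
    (hrel : ∀ s ∈ symbols ψ, ∀ σ : Fin s.1 → Fin n,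
      T.relMap s.2 (fun i => xs (σ i)) ↔ T'.relMap s.2 (fun i => xs' (σ i))) :
    ψ.Realize e xs ↔ ψ.Realize e' xs' := by
  induction h with
  | falsum => exact Iff.rfl
  | @of_isAtomic γ hγ =>
    rcases hγ with ⟨t₁, t₂⟩ | ⟨R, ts⟩
    · obtain ⟨i, rfl⟩ := term_eq_var t₁
      obtain ⟨j, rfl⟩ := term_eq_var t₂
      simpa using heq i j
    · choose σ hσ using fun i => term_eq_var (ts i)
      obtain rfl : ts = fun i => Term.var (Sum.inr (σ i)) := funext hσ
      exact hrel ⟨_, R⟩ rfl σ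
  | imp _ _ ih₁ ih₂ =>
    rw [BoundedFormula.realize_imp, BoundedFormula.realize_imp,
      ih₁ fun s hs => hrel s (Or.inl hs), ih₂ fun s hs => hrel s (Or.inr hs)]

/-- The `1`-type of a node over the signature of `ψ`. -/
def nodeType (ψ : (treeLang U C).Sentence) (T : TreeStructure U C) (a : T.Carrier) :
    Set ((treeLang U C).BoundedFormula Empty 1) :=
  {γ | ((γ.IsAtomic ∨ ∃ δ : (treeLang U C).BoundedFormula Empty 1, δ.IsAtomic ∧ γ = ∼δ) ∧
    symbols γ ⊆ symbols ψ) ∧ γ.Realize Empty.elim ![a]}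

theorem symbols_not {n : ℕ} (γ : (treeLang U C).BoundedFormula Empty n) :
    symbols (∼γ) = symbols γ := by
  change symbols γ ∪ ∅ = symbols γ
  simp

/-- The atom with symbol `s` whose arguments are all `x`. -/
def loopAtom (s : Σ k, TreeRel U C k) : (treeLang U C).BoundedFormula Empty 1 :=
  BoundedFormula.rel (L := treeLang U C) s.2 fun _ => &0

theorem loopAtom_mem_nodeType {ψ : (treeLang U C).Sentence} {T : TreeStructure U C}
    {a : T.Carrier} {s : Σ k, TreeRel U C k} (hs : s ∈ symbols ψ) :
    loopAtom s ∈ nodeType ψ T a ↔ T.relMap s.2 (fun _ => a) := by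
  constructor
  · exact fun h => h.2
  · refine fun h => ⟨⟨Or.inl (BoundedFormula.IsAtomic.rel _ _), ?_⟩, h⟩
    rintro t (rfl : t = _)
    exact hs

/-- With a single variable every relational atom is a loop and equality is trivially true, so the
loops decide the type. -/
theorem nodeType_congr {ψ : (treeLang U C).Sentence} {T T' : TreeStructure U C}
    {a : T.Carrier} {a' : T'.Carrier}
    (h : ∀ s ∈ symbols ψ, T.relMap s.2 (fun _ => a) ↔ T'.relMap s.2 (fun _ => a')) :
    nodeType ψ T a = nodeType ψ T' a' := by
  have key : ∀ γ : (treeLang U C).BoundedFormula Empty 1, γ.IsQF → symbols γ ⊆ symbols ψ →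
      (γ.Realize Empty.elim ![a] ↔ γ.Realize Empty.elim ![a']) := by
    intro γ hγ hs
    refine realize_congr hγ (fun i j => ?_) (fun s hsγ σ => ?_)
    · simp [Subsingleton.elim i j]
    · have e : σ = fun _ => 0 := Subsingleton.elim _ _
      subst e
      exact h s (hs hsγ)
  ext γ
  refine and_congr_right fun hγ => key γ ?_ hγ.2
  rcases hγ.1 with h | ⟨δ, hδ, rfl⟩
  · exact h.isQF
  · exact hδ.isQF.not

/-- Maximality: for each atom over the signature, the node satisfies it or its negation, so a
further literal would contradict one already present. -/
theorem nodeType_mem_oneTypes (ψ : (treeLang U C).Sentence) (T : TreeStructure U C)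
    (a : T.Carrier) : nodeType ψ T a ∈ oneTypes ψ := by
  refine ⟨⟨fun γ hγ => hγ.1, T, a, fun γ hγ => hγ.2⟩, ?_⟩
  rintro Δ ⟨hΔ, T', a', hsat⟩ hle γ hγ
  refine ⟨hΔ γ hγ, ?_⟩
  by_contra hn
  rcases hΔ γ hγ with ⟨hat | ⟨δ, hδ, rfl⟩, hs⟩
  · have : ∼γ ∈ nodeType ψ T a :=
      ⟨⟨Or.inr ⟨γ, hat, rfl⟩, (symbols_not γ).trans_subset hs⟩, hn⟩
    exact hsat _ (hle this) (hsat _ hγ)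
  · rw [symbols_not] at hs
    rw [BoundedFormula.realize_not, not_not] at hn
    exact hsat _ hγ (hsat _ (hle ⟨⟨Or.inl hδ, hs⟩, hn⟩))

theorem exists_nodeType_eq {ψ : (treeLang U C).Sentence}
    {Γ : Set ((treeLang U C).BoundedFormula Empty 1)} (hΓ : Γ ∈ oneTypes ψ) :
    ∃ (T : TreeStructure U C) (a : T.Carrier), nodeType ψ T a = Γ := by
  obtain ⟨⟨hΓl, T, a, hsat⟩, hmax⟩ := hΓ
  have hle : Γ ⊆ nodeType ψ T a := fun γ hγ => ⟨hΓl γ hγ, hsat γ hγ⟩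
  exact ⟨T, a, (hmax (nodeType_mem_oneTypes ψ T a).1 hle).antisymm hle⟩

/-- Stated with `encard` so that it also yields finiteness; `ncard` would be `0` on an infinite set.
-/
theorem encard_symbols_le {α : Type} {n : ℕ} (ψ : (treeLang U C).BoundedFormula α n) :
    (symbols ψ).encard ≤ size ψ := by
  induction ψ with
  | falsum => simp [symbols]
  | equal => simp [symbols]
  | rel R ts => simp [symbols, size]
  | imp f g ih₁ ih₂ =>
    refine (Set.encard_union_le _ _).trans ((add_le_add ih₁ ih₂).trans ?_)
    simp [size]
  | all f ih =>
    refine ih.trans ?_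
    simp [size]

theorem symbols_finite {α : Type} {n : ℕ} (ψ : (treeLang U C).BoundedFormula α n) :
    (symbols ψ).Finite := by
  rw [← Set.encard_lt_top_iff]
  exact (encard_symbols_le ψ).trans_lt (ENat.natCast_lt_top _)

theorem ncard_symbols_le {α : Type} {n : ℕ} (ψ : (treeLang U C).BoundedFormula α n) :
    (symbols ψ).ncard ≤ size ψ := by
  have := encard_symbols_le ψ
  rwa [← (symbols_finite ψ).cast_ncard_eq, Nat.cast_le] at this

theorem mapsTo_loops (ψ : (treeLang U C).Sentence) :
    Set.MapsTo (fun Γ => {s | s ∈ symbols ψ ∧ loopAtom s ∈ Γ}) (oneTypes ψ) (𝒫 (symbols ψ)) :=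
  fun _ _ _ hs => hs.1

theorem injOn_loops (ψ : (treeLang U C).Sentence) :
    Set.InjOn (fun Γ => {s | s ∈ symbols ψ ∧ loopAtom s ∈ Γ}) (oneTypes ψ) := by
  intro Γ hΓ Γ' hΓ' he
  obtain ⟨T, a, rfl⟩ := exists_nodeType_eq hΓ
  obtain ⟨T', a', rfl⟩ := exists_nodeType_eq hΓ'
  refine nodeType_congr fun s hs => ?_
  have := Set.ext_iff.1 he s
  simp only [Set.mem_ofPred_eq, hs, true_and, loopAtom_mem_nodeType hs] at this
  exact this

theorem oneTypes_finite (ψ : (treeLang U C).Sentence) : (oneTypes ψ).Finite :=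
  Set.Finite.of_injOn (mapsTo_loops ψ) (injOn_loops ψ) (symbols_finite ψ).powerset

theorem ncard_oneTypes_le (ψ : (treeLang U C).Sentence) :
    (oneTypes ψ).ncard ≤ 2 ^ size ψ := by
  refine (Set.ncard_le_ncard_of_injOn _ (mapsTo_loops ψ) (injOn_loops ψ)
    (symbols_finite ψ).powerset).trans ?_
  rw [Set.ncard_powerset _ (symbols_finite ψ)]
  exact Nat.pow_le_pow_right (by norm_num) (ncard_symbols_le ψ)

theorem length_add_size_le (l : List (Conjunct U C)) (ψ : (treeLang U C).Sentence) :
    l.length + size ψ ≤ size (l.foldl (fun ψ c => ψ ⊓ c.toSentence) ψ) := by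
  induction l generalizing ψ with
  | nil => simp
  | cons c l ih =>
    refine le_trans ?_ (ih (ψ ⊓ c.toSentence))
    have : size ψ + 1 ≤ size (ψ ⊓ c.toSentence) := by
      change size ψ + 1 ≤ (size ψ + (size c.toSentence + 1 + 1) + 1) + 1 + 1
      omega
    simp only [List.length_cons]
    omega

theorem NormalForm.m_le_size (φ : NormalForm U C) : φ.m ≤ size φ.toSentence :=
  le_trans (Nat.le_add_right _ _) (length_add_size_le φ.conjuncts _)

/-- With `s` the size, `96 ≤ 2 ^ 7` and both `m` and the number of types are at most `2 ^ s`;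
finally `7 + 6 * s ≤ 13 * s` because `s ≥ 1`. -/
theorem NormalForm.bound_le (φ : NormalForm U C) : φ.bound ≤ 2 ^ (13 * size φ.toSentence) := by
  set s := size φ.toSentence with hs
  have hm : φ.m ≤ 2 ^ s := φ.m_le_size.trans (Nat.lt_two_pow_self).le
  have hn := ncard_oneTypes_le φ.toSentence
  rw [← hs] at hn
  have h0 : 1 ≤ s := by
    refine le_trans ?_ (le_trans (Nat.le_add_left _ _) (length_add_size_le φ.conjuncts _))
    change 1 ≤ size φ.matrix + 2 + 2
    omega
  calc φ.bound = 96 * φ.m ^ 3 * (oneTypes φ.toSentence).ncard ^ 3 := rfl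
    _ ≤ 2 ^ 7 * (2 ^ s) ^ 3 * (2 ^ s) ^ 3 := by gcongr; norm_num
    _ = 2 ^ (7 + 6 * s) := by ring
    _ ≤ 2 ^ (13 * s) := Nat.pow_le_pow_right (by norm_num) (by omega)

theorem subset_symbols_foldl (l : List (Conjunct U C)) (ψ : (treeLang U C).Sentence) :
    symbols ψ ⊆ symbols (l.foldl (fun ψ c => ψ ⊓ c.toSentence) ψ) ∧
      ∀ c ∈ l, symbols c.toSentence ⊆ symbols (l.foldl (fun ψ c => ψ ⊓ c.toSentence) ψ) := by
  induction l generalizing ψ with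
  | nil => simp
  | cons c l ih =>
    obtain ⟨h1, h2⟩ := ih (ψ ⊓ c.toSentence)
    have h3 : symbols (ψ ⊓ c.toSentence) = symbols ψ ∪ symbols c.toSentence := by
      change (symbols ψ ∪ (symbols c.toSentence ∪ ∅)) ∪ ∅ = _
      simp
    rw [h3] at h1
    refine ⟨Set.subset_union_left.trans h1, fun c' hc' => ?_⟩
    rcases List.mem_cons.1 hc' with rfl | hc'
    · exact Set.subset_union_right.trans h1
    · exact h2 c' hc'

theorem NormalForm.symbols_matrix_subset (φ : NormalForm U C) :
    symbols φ.matrix ⊆ symbols φ.toSentence :=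
  (subset_symbols_foldl φ.conjuncts (∀' ∀' φ.matrix)).1

theorem symbols_conjunct (c : Conjunct U C) :
    symbols c.toSentence = {⟨1, .unary c.guard⟩} ∪
      (symbols (c.position.toFormula (U := U) (C := C)) ∪ symbols c.matrix) := by
  change {⟨1, .unary c.guard⟩} ∪ ((((symbols (c.position.toFormula (U := U) (C := C)) ∪
    (symbols c.matrix ∪ ∅)) ∪ ∅) ∪ ∅) ∪ ∅) = _
  simp

theorem NormalForm.symbols_conjunct_subset (φ : NormalForm U C) {c : Conjunct U C}
    (hc : c ∈ φ.conjuncts) : symbols c.matrix ⊆ symbols φ.toSentence := by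
  refine Set.Subset.trans ?_ ((subset_symbols_foldl φ.conjuncts _).2 c hc)
  rw [symbols_conjunct]
  exact Set.subset_union_right.trans Set.subset_union_right

theorem NormalForm.guard_mem_symbols (φ : NormalForm U C) {c : Conjunct U C}
    (hc : c ∈ φ.conjuncts) : ⟨1, .unary c.guard⟩ ∈ symbols φ.toSentence := by
  refine (subset_symbols_foldl φ.conjuncts _).2 c hc ?_
  rw [symbols_conjunct]
  exact Or.inl rfl

theorem realize_xNy (T : TreeStructure U C) (N : Nav) (e : Empty → T.Carrier)
    (a b : T.Carrier) : (xNy (U := U) (C := C) N).Realize e ![a, b] ↔ T.nav N a b := Iff.rfl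

theorem realize_yNx (T : TreeStructure U C) (N : Nav) (e : Empty → T.Carrier)
    (a b : T.Carrier) : (yNx (U := U) (C := C) N).Realize e ![a, b] ↔ T.nav N b a := Iff.rfl

theorem realize_toFormula (T : TreeStructure U C) (θ : OrderFormula) (e : Empty → T.Carrier)
    (a b : T.Carrier) : (θ.toFormula (U := U) (C := C)).Realize e ![a, b] ↔
      θ.Holds T.child T.next a b := by
  cases θ <;>
    simp [OrderFormula.toFormula, realize_xNy, realize_yNx, xEqy, OrderFormula.Holds,
      TreeStructure.nav, and_assoc]

theorem snoc_snoc {M : Type*} (x y : M) :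
    (Fin.snoc (Fin.snoc (default : Fin 0 → M) x : Fin 1 → M) y : Fin 2 → M) = ![x, y] := by
  funext i
  fin_cases i <;> rfl

theorem realize_conjunct (T : TreeStructure U C) (c : Conjunct U C) :
    Sentence.Realize T.Carrier c.toSentence ↔ ∀ x, T.unary c.guard x →
      ∃ y, c.position.Holds T.child T.next x y ∧
        c.matrix.Realize (default : Empty → T.Carrier) ![x, y] := by
  simp only [Sentence.Realize, Formula.Realize, Conjunct.toSentence, BoundedFormula.realize_all,
    BoundedFormula.realize_imp,
    BoundedFormula.realize_ex, BoundedFormula.realize_inf, snoc_snoc, realize_toFormula]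
  exact Iff.rfl

theorem NormalForm.realize_toSentence (T : TreeStructure U C) (φ : NormalForm U C) :
    Sentence.Realize T.Carrier φ.toSentence ↔
      (∀ x y, φ.matrix.Realize (default : Empty → T.Carrier) ![x, y]) ∧
      ∀ c ∈ φ.conjuncts, ∀ x, T.unary c.guard x → ∃ y, c.position.Holds T.child T.next x y ∧
        c.matrix.Realize (default : Empty → T.Carrier) ![x, y] := by
  have key : ∀ (l : List (Conjunct U C)) (ψ : (treeLang U C).Sentence),
      Sentence.Realize T.Carrier (l.foldl (fun ψ c => ψ ⊓ c.toSentence) ψ) ↔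
        Sentence.Realize T.Carrier ψ ∧ ∀ c ∈ l, Sentence.Realize T.Carrier c.toSentence := by
    intro l
    induction l with
    | nil => simp
    | cons c l ih =>
      intro ψ
      rw [List.foldl_cons, ih]
      simp only [Sentence.Realize, Formula.Realize, BoundedFormula.realize_inf, List.mem_cons,
        forall_eq_or_imp, and_assoc]
  rw [NormalForm.toSentence, key]
  simp only [realize_conjunct]
  simp only [Sentence.Realize, Formula.Realize, BoundedFormula.realize_all, snoc_snoc]

/-- The tree structure with given tree relations whose uninterpreted symbols are read off from the
nodes and pairs of nodes of another structure. -/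
def TreeStructure.pullback (T : TreeStructure U C) {V : Type} [Finite V] {child next : V → V → Prop}
    (hV : IsOrderedTree child next) (e : V → T.Carrier) (π : V → V → T.Carrier × T.Carrier) :
    TreeStructure U C where
  Carrier := V
  finite := inferInstance
  child := child
  next := next
  isTree := hV
  unary A x := T.unary A (e x)
  common R x y := T.common R (π x y).1 (π x y).2

/-- A tree whose pairs of nodes look like pairs of nodes of a model of `φ`, with their witnesses, can
be made a model of `φ`. -/
theorem NormalForm.exists_model (φ : NormalForm U C) (T : TreeStructure U C)
    (hT : Sentence.Realize T.Carrier φ.toSentence) {V : Type} [Finite V] {child next : V → V → Prop}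
    (hV : IsOrderedTree child next) (e : V → T.Carrier) (π : V → V → T.Carrier × T.Carrier)
    (hswap : ∀ x y, π y x = (π x y).swap) (hdiag : ∀ x, π x x = (e x, e x))
    (htype : ∀ x y, nodeType φ.toSentence T (π x y).1 = nodeType φ.toSentence T (e x))
    (hpos : ∀ x y, relPos T.child T.next (π x y).1 (π x y).2 = relPos child next x y)
    (hwit : ∀ c ∈ φ.conjuncts, ∀ x, T.unary c.guard (e x) → ∃ y,
      c.position.Holds T.child T.next (π x y).1 (π x y).2 ∧
        c.matrix.Realize (default : Empty → T.Carrier) ![(π x y).1, (π x y).2]) :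
    ∃ T' : TreeStructure U C, T'.Carrier = V ∧ Sentence.Realize T'.Carrier φ.toSentence := by
  refine ⟨T.pullback hV e π, rfl, ?_⟩
  have htype2 : ∀ x y, nodeType φ.toSentence T (π x y).2 = nodeType φ.toSentence T (e y) := by
    intro x y
    rw [← htype y x, hswap x y]; rfl
  have hloop : ∀ s ∈ symbols φ.toSentence, ∀ a b : T.Carrier,
      nodeType φ.toSentence T a = nodeType φ.toSentence T b →
      (T.relMap s.2 (fun _ => a) ↔ T.relMap s.2 (fun _ => b)) := by
    intro s hs a b hab
    rw [← loopAtom_mem_nodeType hs, ← loopAtom_mem_nodeType hs, hab]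
  have hloop' : ∀ s ∈ symbols φ.toSentence, ∀ x : V,
      ((T.pullback hV e π).relMap s.2 (fun _ => x) ↔ T.relMap s.2 (fun _ => e x)) := by
    rintro ⟨_, A | N | R⟩ hs x
    · exact Iff.rfl
    · have := (hV.navAgree_of_relPos_eq T.isTree (a := x) (b := x) (a' := e x) (b' := e x)
        (by rw [IsOrderedTree.relPos_self, IsOrderedTree.relPos_self]))
      cases N
      · exact this.child_iff
      · exact this.desc_iff
      · exact this.next_iff
      · exact this.foll_iff
    · change T.common R (π x x).1 (π x x).2 ↔ _
      rw [hdiag]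
      exact Iff.rfl
  have hpair : ∀ s ∈ symbols φ.toSentence, ∀ x y : V, ∀ σ : Fin s.1 → Fin 2,
      ((T.pullback hV e π).relMap s.2 (fun i => (![x, y] : Fin 2 → V) (σ i)) ↔
        T.relMap s.2 (fun i => ![(π x y).1, (π x y).2] (σ i))) := by
    intro s hs x y σ
    have h0 := (hloop' s hs x).trans (hloop s hs _ _ (htype x y)).symm
    have h1 := (hloop' s hs y).trans (hloop s hs _ _ (htype2 x y)).symm
    -- Constant arguments give a loop, governed by the type; otherwise the symbol is binary and is
    -- applied to the pair or to its swap.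
    by_cases hc : ∃ k, σ = fun _ => k
    · obtain ⟨k, rfl⟩ := hc
      fin_cases k
      · exact h0
      · exact h1
    · have hxy := hV.navAgree_of_relPos_eq T.isTree (hpos x y).symm
      have hyx := hV.navAgree_of_relPos_eq T.isTree (a := y) (b := x) (a' := (π x y).2)
        (b' := (π x y).1) (by rw [← hpos, hswap x y]; rfl)
      obtain ⟨_, A | N | R⟩ := s
      · exact absurd ⟨σ 0, funext fun i => by rw [Subsingleton.elim i 0]⟩ hc
      all_goals
        have hσ : (σ 0 = 0 ∧ σ 1 = 1) ∨ (σ 0 = 1 ∧ σ 1 = 0) := by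
          have : σ 0 ≠ σ 1 := fun h => hc ⟨σ 0, funext fun i => by fin_cases i; rfl; exact h.symm⟩
          change Fin 2 → Fin 2 at σ
          omega
      · change (T.pullback hV e π).nav N (![x, y] (σ 0)) (![x, y] (σ 1)) ↔
          T.nav N (![(π x y).1, (π x y).2] (σ 0)) (![(π x y).1, (π x y).2] (σ 1))
        rcases hσ with ⟨e0, e1⟩ | ⟨e0, e1⟩ <;> rw [e0, e1] <;> cases N
        · exact hxy.child_iff
        · exact hxy.desc_iff
        · exact hxy.next_iff
        · exact hxy.foll_iff
        · exact hyx.child_iff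
        · exact hyx.desc_iff
        · exact hyx.next_iff
        · exact hyx.foll_iff
      · change (T.pullback hV e π).common R (![x, y] (σ 0)) (![x, y] (σ 1)) ↔
          T.common R (![(π x y).1, (π x y).2] (σ 0)) (![(π x y).1, (π x y).2] (σ 1))
        rcases hσ with ⟨e0, e1⟩ | ⟨e0, e1⟩ <;> rw [e0, e1]
        · exact Iff.rfl
        · change T.common R (π y x).1 (π y x).2 ↔ T.common R (π x y).2 (π x y).1
          rw [hswap x y]
          exact Iff.rfl
  have hreal : ∀ ψ : (treeLang U C).BoundedFormula Empty 2, ψ.IsQF →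
      symbols ψ ⊆ symbols φ.toSentence → ∀ x y : V,
      (ψ.Realize (default : Empty → (T.pullback hV e π).Carrier)
          (![x, y] : Fin 2 → (T.pullback hV e π).Carrier) ↔
        ψ.Realize (default : Empty → T.Carrier) ![(π x y).1, (π x y).2]) := by
    intro ψ hψ hs x y
    refine realize_congr hψ (fun i j => ?_) fun s hsψ σ => hpair s (hs hsψ) x y σ
    have h := (hV.navAgree_of_relPos_eq T.isTree (hpos x y).symm).eq_iff
    fin_cases i <;> fin_cases j
    · exact ⟨fun _ => rfl, fun _ => rfl⟩
    · exact h
    · exact eq_comm.trans (h.trans eq_comm)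
    · exact ⟨fun _ => rfl, fun _ => rfl⟩
  rw [NormalForm.realize_toSentence] at hT
  refine (φ.realize_toSentence (T.pullback hV e π)).2 ⟨fun x y =>
    (hreal _ φ.isQF φ.symbols_matrix_subset x y).2 (hT.1 _ _),
    fun c hc x hx => ?_⟩
  obtain ⟨y, hy, hy'⟩ := hwit c hc x hx
  refine ⟨y, ?_, (hreal _ c.isQF (φ.symbols_conjunct_subset hc) x y).2 hy'⟩
  rw [T.isTree.holds_iff, hpos x y] at hy
  exact hV.holds_iff.2 hy

end Models

/-! ### Extremal choice, pigeonhole and the abstract notion of a spine. -/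

/-- Greedy choice of elements of maximal rank. An element left out certifies that the choice has
full size `s` and consists of elements of at least its rank. -/
theorem exists_top {V α : Type*} [DecidableEq V] [LinearOrder α] (r : V → α) (B : Finset V)
    (s : ℕ) : ∃ F ⊆ B, F.card ≤ s ∧ ∀ b ∈ B, b ∉ F → F.card = s ∧ ∀ f ∈ F, r b ≤ r f := by
  induction s with
  | zero => exact ⟨∅, by simp, by simp, by simp⟩
  | succ s ih =>
    obtain ⟨F, hFB, hF, h⟩ := ih
    rcases (B \ F).eq_empty_or_nonempty with he | hne
    · refine ⟨F, hFB, by omega, fun b hb hbF => ?_⟩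
      have : b ∈ B \ F := Finset.mem_sdiff.2 ⟨hb, hbF⟩
      simp [he] at this
    · obtain ⟨m, hm, hmax⟩ := Finset.exists_max_image (B \ F) r hne
      obtain ⟨hmB, hmF⟩ := Finset.mem_sdiff.1 hm
      have hs := (h m hmB hmF).1
      have hc : (insert m F).card = s + 1 := by rw [Finset.card_insert_of_notMem hmF, hs]
      refine ⟨insert m F, Finset.insert_subset hmB hFB, hc.le, fun b hb hbF => ⟨hc, ?_⟩⟩
      simp only [Finset.mem_insert, not_or] at hbF
      intro f hf
      rcases Finset.mem_insert.1 hf with rfl | hf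
      · exact hmax b (Finset.mem_sdiff.2 ⟨hb, hbF.2⟩)
      · exact (h b hb hbF.2).2 f hf

/-- If `Q` is small in comparison with the number `d` of spine nodes, then two spine nodes of the
same type are separated and surrounded by ranks that do not occur in `Q`. -/
theorem exists_equal_types {τ : Type*} [Fintype τ] (t : ℕ → τ) (R : Finset ℕ) (d : ℕ)
    (hd : (R.card + 1) * (Fintype.card τ + 2) ≤ d) :
    ∃ i j, 2 ≤ i ∧ i < j ∧ j ≤ d ∧ t i = t j ∧ ∀ r ∈ R, r + 1 < i ∨ j < r := by
  set n := Fintype.card τ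
  -- Block `q` consists of the `n + 2` ranks from `q * (n + 2) + 1` on. There are more blocks than
  -- elements of `R`, so some block avoids `R`; rank `0` is counted in block `0`, which does no
  -- harm.
  obtain ⟨q, hq, hqR⟩ : ∃ q ∈ Finset.range (R.card + 1),
      q ∉ R.image (fun r => (r - 1) / (n + 2)) := by
    by_contra! hcon
    have h1 := Finset.card_le_card hcon
    have h2 := Finset.card_image_le (s := R) (f := fun r => (r - 1) / (n + 2))
    simp only [Finset.card_range] at h1
    omega
  have hq' : (q + 1) * (n + 2) ≤ d := by
    refine le_trans (Nat.mul_le_mul_right _ ?_) hd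
    have := Finset.mem_range.1 hq
    omega
  -- The first rank of the block is left out, so that `i - 1` lies in the block too and is at least
  -- `1`.
  obtain ⟨a, b, hab, htab⟩ : ∃ a b : Fin (n + 1), a < b ∧
      t (q * (n + 2) + 2 + a) = t (q * (n + 2) + 2 + b) := by
    obtain ⟨a, b, hne, he⟩ := Fintype.exists_ne_map_eq_of_card_lt
      (fun a : Fin (n + 1) => t (q * (n + 2) + 2 + a)) (by simp [n])
    rcases lt_or_gt_of_ne hne with h | h
    · exact ⟨a, b, h, he⟩
    · exact ⟨b, a, h, he.symm⟩
  have ha := a.2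
  have hb := b.2
  have hab' : (a : ℕ) < b := hab
  have hexp : (q + 1) * (n + 2) = q * (n + 2) + n + 2 := by ring
  refine ⟨_, _, by omega, by omega, by omega, htab, fun r hr => ?_⟩
  by_contra! hcon
  apply hqR
  refine Finset.mem_image.2 ⟨r, hr, ?_⟩
  rw [Nat.div_eq_iff (by omega)]
  generalize q * (n + 2) = z at *
  omega

/-- A spine of length `d` in a set `V` with positions `pos`: nodes `c 1, …, c d`, and a rank
function telling for each node to which of the segments given by the spine it belongs (rank `0`
stands for the nodes outside these segments). The position of a node relative to other nodes
depends, up to exceptions near the spine, only on the order of the ranks and on membership in the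
spine. -/
structure IsSpine {V P : Type*} (pos : V → V → P) (d : ℕ) (c : ℕ → V) (rank : V → ℕ) : Prop where
  rank_spine : ∀ l, 1 ≤ l → l ≤ d → rank (c l) = l
  pos_above : ∀ x b f, rank x < rank b → rank x < rank f → b ≠ c (rank x + 1) →
    f ≠ c (rank x + 1) → (b = c (rank b) ↔ f = c (rank f)) → pos x b = pos x f
  pos_below : ∀ y b f, 1 ≤ rank b → 1 ≤ rank f → rank b < rank y → rank f < rank y →
    (y = c (rank y) → rank b + 1 < rank y ∧ rank f + 1 < rank y) →
    (b = c (rank b) ↔ f = c (rank f)) → pos y b = pos y f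
  pos_adjacent : ∀ i j b, 2 ≤ i → i < j → j ≤ d → rank b + 1 = j →
    (∀ f, 1 ≤ rank f → rank f + 1 < j → (b = c (rank b) ↔ f = c (rank f)) →
      pos (c j) b = pos (c j) f) ∨
    ∀ b', pos (c i) b' = pos (c j) b → rank b' + 1 = i

open Classical in
/-- The pair to which a pair of nodes corresponds when `v` takes the place of `u`, the ranks below
`i` being those of the nodes above. -/
noncomputable def basePair {V : Type*} (rank : V → ℕ) (i : ℕ) (u v x y : V) : V × V :=
  -- Only rank `i - 1` needs the copy. Nodes of smaller rank see `u` and `v` in the same position,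
  -- and leaving those pairs alone preserves the witnesses that `v` has there.
  if rank x + 1 = i ∧ y = v then (x, u) else if rank y + 1 = i ∧ x = v then (u, y) else (x, y)

theorem basePair_swap {V : Type*} {rank : V → ℕ} {i : ℕ} {u v : V} (hv : rank v + 1 ≠ i)
    (x y : V) : basePair rank i u v y x = (basePair rank i u v x y).swap := by
  simp only [basePair]
  by_cases h1 : rank x + 1 = i ∧ y = v
  · have h2 : ¬ (rank y + 1 = i ∧ x = v) := by
      rintro ⟨h, -⟩
      exact hv (h1.2 ▸ h)
    rw [if_neg h2, if_pos h1, if_pos h1]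
    rfl
  · rw [if_neg h1, if_neg h1]
    split_ifs <;> rfl

/-! ### Redirecting witnesses and contracting a spine. -/

section Redirect

variable {V τ P : Type*} {m : ℕ}

open Classical in
/-- The set of witnesses of the nodes in a set. -/
noncomputable def witnesses (w : Fin m → V → V) (S : Finset V) : Finset V :=
  S.biUnion fun x => Finset.univ.image fun k => w k x

theorem card_witnesses_le (w : Fin m → V → V) (S : Finset V) :
    (witnesses w S).card ≤ S.card * m := by
  classical
  refine Finset.card_biUnion_le_card_mul _ _ _ fun x _ => ?_
  exact Finset.card_image_le.trans (by simp)

theorem mem_witnesses (w : Fin m → V → V) {S : Finset V} {x : V} (hx : x ∈ S) (k : Fin m) :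
    w k x ∈ witnesses w S := by
  classical
  exact Finset.mem_biUnion.2 ⟨x, hx, Finset.mem_image_of_mem _ (Finset.mem_univ _)⟩

open Classical in
/-- The possible replacements for a witness `b` of `x`. -/
noncomputable def candidates (pos : V → V → P) (tp : V → τ) (rank : V → ℕ) (F : Finset V)
    (i j : ℕ) (x b : V) : Finset V :=
  F.filter fun f => (rank f + 1 < i ∨ j < rank f) ∧ tp f = tp b ∧ pos x f = pos x b

/-- Witnesses in the ranks from `i - 1` to `j` can be replaced by elements of `F`. -/
theorem exists_redirect (pos : V → V → P) (tp : V → τ) (rank : V → ℕ) (F : Finset V)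
    (w : Fin m → V → V) (i j : ℕ) (u v : V) (hv : rank v = j) (hij : i < j)
    (flip : P → P) (hflip : ∀ x y, pos y x = flip (pos x y)) (htp : tp u = tp v)
    (hF : ∀ x, x ∈ F ∨ x ∈ witnesses w F → ∀ k, rank (w k x) + 1 < i ∨ j < rank (w k x)) :
    ∃ π : V → V → V × V, (∀ x y, π y x = (π x y).swap) ∧ (∀ x, π x x = (x, x)) ∧
      (∀ x y, tp (π x y).1 = tp x) ∧
      (∀ x y, pos (π x y).1 (π x y).2 =
        pos (basePair rank i u v x y).1 (basePair rank i u v x y).2) ∧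
      (∀ x k, i ≤ rank (w k x) + 1 → rank (w k x) ≤ j →
        2 * m ≤ (candidates pos tp rank F i j x (w k x)).card →
        ∃ y, (rank y + 1 < i ∨ j < rank y) ∧ π x y = (x, w k x)) ∧
      (∀ x k, basePair rank i u v x (w k x) = (x, w k x) → π x (w k x) = (x, w k x)) ∧
      (∀ x y, i ≤ rank x + 1 → rank x ≤ j → i ≤ rank y + 1 → rank y ≤ j →
        π x y = basePair rank i u v x y) := by
  classical
  let red : V → Fin m → Prop := fun x k => i ≤ rank (w k x) + 1 ∧ rank (w k x) ≤ j ∧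
    2 * m ≤ (candidates pos tp rank F i j x (w k x)).card
  -- Hall's condition is immediate: removing the at most `m` witnesses of `x` from `2 * m`
  -- candidates leaves `m`, at least the number of conjuncts to be served.
  have hall : ∀ x, ∃ g : {k // red x k} → V, Function.Injective g ∧
      ∀ k : {k // red x k}, g k ∈ candidates pos tp rank F i j x (w k x) \
        Finset.univ.image (fun k => w k x) := by
    intro x
    rw [← Finset.all_card_le_biUnion_card_iff_exists_injective
      (fun k : {k // red x k} => candidates pos tp rank F i j x (w k x) \
        Finset.univ.image (fun k => w k x))]
    intro S
    rcases S.eq_empty_or_nonempty with rfl | ⟨k, hk⟩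
    · simp
    · have h1 : S.card ≤ m := by
        refine S.card_le_univ.trans ?_
        simpa using Fintype.card_subtype_le (red x)
      have h2 := Finset.card_le_card (Finset.subset_biUnion_of_mem
        (fun k : {k // red x k} => candidates pos tp rank F i j x (w k x) \
          Finset.univ.image (fun k => w k x)) hk)
      have h3 := Finset.le_card_sdiff (Finset.univ.image (fun k => w k x))
        (candidates pos tp rank F i j x (w k x))
      have h4 : (Finset.univ.image (fun k => w k x)).card ≤ m :=
        Finset.card_image_le.trans (by simp)
      have h5 := k.2.2.2
      omega
  choose g hginj hg using hall
  have gC : ∀ x (k : {k // red x k}), g x k ∈ F ∧ (rank (g x k) + 1 < i ∨ j < rank (g x k)) ∧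
      tp (g x k) = tp (w k x) ∧ pos x (g x k) = pos x (w k x) := fun x k =>
    Finset.mem_filter.1 (Finset.mem_sdiff.1 (hg x k)).1
  have gW : ∀ x (k : {k // red x k}) k', w k' x ≠ g x k := fun x k k' e =>
    (Finset.mem_sdiff.1 (hg x k)).2 (Finset.mem_image.2 ⟨k', Finset.mem_univ _, e⟩)
  -- No redirection starts in `F`, so a pair is never redefined from both sides. None starts at a
  -- witness of `F` either, so no pair of an element of `F` with its witness is overwritten.
  have redF : ∀ x (_ : {k // red x k}), ¬ (x ∈ F ∨ x ∈ witnesses w F) := by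
    intro x k hx
    have h1 := hF x hx k
    have h2 := k.2.1
    have h3 := k.2.2.1
    omega
  have redF1 : ∀ x (_ : {k // red x k}), x ∉ F := fun x k hx =>
    redF x k (Or.inl hx)
  let base := basePair rank i u v
  have base_swap : ∀ x y, base y x = (base x y).swap := basePair_swap (by omega)
  have base_id : ∀ x y, (rank y + 1 < i ∨ j < rank y) → base x y = (x, y) := by
    intro x y hy
    simp only [base, basePair]
    rw [if_neg, if_neg]
    · rintro ⟨h, -⟩; omega
    · rintro ⟨-, h⟩; rw [h, hv] at hy; omega
  let π : V → V → V × V := fun x y =>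
    if h : ∃ k : {k // red x k}, g x k = y then (x, w h.choose x)
    else if h : ∃ k : {k // red y k}, g y k = x then (w h.choose y, y) else base x y
  have π1 : ∀ x (k : {k // red x k}), π x (g x k) = (x, w k x) := by
    intro x k
    have h : ∃ k' : {k // red x k}, g x k' = g x k := ⟨k, rfl⟩
    have hk : h.choose = k := hginj x h.choose_spec
    simp only [π]
    rw [dif_pos h, hk]
  have not_both : ∀ x (k : {k // red x k}), ¬ ∃ k' : {k' // red (g x k) k'}, g (g x k) k' = x := by
    rintro x k ⟨k', -⟩
    exact redF1 _ k' (gC x k).1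
  have π2 : ∀ x (k : {k // red x k}), π (g x k) x = (w k x, x) := by
    intro x k
    have h : ∃ k' : {k // red x k}, g x k' = g x k := ⟨k, rfl⟩
    have hk : h.choose = k := hginj x h.choose_spec
    simp only [π]
    rw [dif_neg (not_both x k), dif_pos h, hk]
  have π3 : ∀ x y, (¬ ∃ k : {k // red x k}, g x k = y) → (¬ ∃ k : {k // red y k}, g y k = x) →
      π x y = base x y := by
    intro x y h1 h2
    simp only [π]
    rw [dif_neg h1, dif_neg h2]
  have hcases : ∀ (p : V → V → Prop), (∀ x (k : {k // red x k}), p x (g x k)) →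
      (∀ x (k : {k // red x k}), p (g x k) x) → (∀ x y, π x y = base x y → π y x = base y x →
        p x y) → ∀ x y, p x y := by
    intro p h1 h2 h3 x y
    by_cases e1 : ∃ k : {k // red x k}, g x k = y
    · obtain ⟨k, rfl⟩ := e1; exact h1 x k
    · by_cases e2 : ∃ k : {k // red y k}, g y k = x
      · obtain ⟨k, rfl⟩ := e2; exact h2 y k
      · exact h3 x y (π3 x y e1 e2) (π3 y x e2 e1)
  refine ⟨π, ?_, ?_, ?_, ?_, ?_, ?_, ?_⟩
  · refine hcases _ (fun x k => ?_) (fun x k => ?_) (fun x y h1 h2 => ?_)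
    · rw [π1, π2]; rfl
    · rw [π1, π2]; rfl
    · rw [h1, h2, base_swap]
  · intro x
    have h : ¬ ∃ k : {k // red x k}, g x k = x := by
      rintro ⟨k, hk⟩
      have := (gC x k).1
      rw [hk] at this
      exact redF1 x k this
    rw [π3 x x h h]
    have h1 : ¬ (rank x + 1 = i ∧ x = v) := by
      rintro ⟨h, rfl⟩; omega
    simp [base, basePair, h1]
  · refine hcases _ (fun x k => ?_) (fun x k => ?_) (fun x y h1 h2 => ?_)
    · rw [π1]
    · rw [π2]; exact (gC x k).2.2.1.symm
    · rw [h1]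
      simp only [base, basePair]
      split_ifs with h3 h4
      · rfl
      · rw [h4.2]; exact htp
      · rfl
  · refine hcases _ (fun x k => ?_) (fun x k => ?_) (fun x y h1 h2 => ?_)
    · rw [π1]
      change _ = pos (base _ _).1 (base _ _).2
      rw [base_id _ _ (gC x k).2.1]
      exact (gC x k).2.2.2.symm
    · rw [π2]
      change _ = pos (base _ _).1 (base _ _).2
      rw [base_swap, base_id _ _ (gC x k).2.1]
      simp only [Prod.swap, hflip x]
      rw [(gC x k).2.2.2]
    · rw [h1]
  · intro x k h1 h2 h3
    exact ⟨g x ⟨k, h1, h2, h3⟩, (gC x _).2.1, π1 x ⟨k, h1, h2, h3⟩⟩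
  · intro x k hk
    rw [π3]
    · exact hk
    · rintro ⟨k', hk'⟩
      exact gW x k' k hk'.symm
    · rintro ⟨k', hk'⟩
      refine redF _ k' (Or.inr ?_)
      have : x ∈ F := hk' ▸ (gC _ k').1
      exact mem_witnesses w this k
  -- Every redirected pair has a member in `F` with rank outside `[i - 1, j]`.
  · intro x y h1 h2 h3 h4
    rw [π3]
    · rintro ⟨k', hk'⟩
      have := (gC _ k').2.1
      rw [hk'] at this
      omega
    · rintro ⟨k', hk'⟩
      have := (gC _ k').2.1
      rw [hk'] at this
      omega

/-- A small set with elements of all types, on and off the spine, with high and with low ranks. -/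
theorem exists_repository [Fintype V] [Fintype τ] (tp : V → τ) (c : ℕ → V) (rank : V → ℕ) (s : ℕ) :
    ∃ F : Finset V, F.card ≤ 4 * s * Fintype.card τ ∧ (∀ f ∈ F, 1 ≤ rank f) ∧
      ∀ b, b ∉ F → 1 ≤ rank b →
        (∃ G ⊆ F, G.card = s ∧ ∀ f ∈ G, tp f = tp b ∧ (b = c (rank b) ↔ f = c (rank f)) ∧
          rank b ≤ rank f) ∧
        (∃ G ⊆ F, G.card = s ∧ ∀ f ∈ G, tp f = tp b ∧ (b = c (rank b) ↔ f = c (rank f)) ∧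
          rank f ≤ rank b) := by
  classical
  let kind : V → Bool := fun b => decide (b = c (rank b))
  let B : τ × Bool → Finset V := fun p =>
    Finset.univ.filter fun b => 1 ≤ rank b ∧ tp b = p.1 ∧ kind b = p.2
  choose H hHB hHs hH using fun p => exists_top rank (B p) s
  -- The dual order selects the lowest ranks. The factor `4` in the bound is two ends times two
  -- kinds.
  choose L hLB hLs hL using fun p => exists_top (OrderDual.toDual ∘ rank) (B p) s
  have hkind : ∀ b f, kind f = kind b → (b = c (rank b) ↔ f = c (rank f)) := by
    intro b f h
    simp only [kind, decide_eq_decide] at h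
    exact h.symm
  refine ⟨Finset.univ.biUnion fun p => H p ∪ L p, ?_, ?_, ?_⟩
  · refine (Finset.card_biUnion_le_card_mul _ _ (2 * s) fun p _ => ?_).trans ?_
    · exact (Finset.card_union_le _ _).trans (by have := hHs p; have := hLs p; omega)
    · simp only [Finset.card_univ, Fintype.card_prod, Fintype.card_bool]
      apply le_of_eq; ring
  · intro f hf
    obtain ⟨p, -, hp⟩ := Finset.mem_biUnion.1 hf
    rcases Finset.mem_union.1 hp with hp | hp
    · exact (Finset.mem_filter.1 (hHB p hp)).2.1
    · exact (Finset.mem_filter.1 (hLB p hp)).2.1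
  · intro b hbF hb
    have hbB : b ∈ B (tp b, kind b) := Finset.mem_filter.2 ⟨Finset.mem_univ _, hb, rfl, rfl⟩
    have hsub : ∀ p, H p ∪ L p ⊆ Finset.univ.biUnion fun p => H p ∪ L p := fun p =>
      Finset.subset_biUnion_of_mem (fun p => H p ∪ L p) (Finset.mem_univ p)
    have hbH : b ∉ H (tp b, kind b) := fun h => hbF (hsub _ (Finset.mem_union_left _ h))
    have hbL : b ∉ L (tp b, kind b) := fun h => hbF (hsub _ (Finset.mem_union_right _ h))
    refine ⟨⟨H (tp b, kind b), Finset.subset_union_left.trans (hsub _), (hH _ b hbB hbH).1,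
      fun f hf => ?_⟩, ⟨L (tp b, kind b), Finset.subset_union_right.trans (hsub _),
      (hL _ b hbB hbL).1, fun f hf => ?_⟩⟩
    · have h1 := (Finset.mem_filter.1 (hHB _ hf)).2
      exact ⟨h1.2.1, hkind _ _ h1.2.2, (hH _ b hbB hbH).2 f hf⟩
    · have h1 := (Finset.mem_filter.1 (hLB _ hf)).2
      exact ⟨h1.2.1, hkind _ _ h1.2.2, (hL _ b hbB hbL).2 f hf⟩

/-- The contraction of a long spine: two spine nodes `c i` and `c j` such that the nodes of ranks
`i, …, j - 1` can be removed, `c j` taking the place of `c i`. -/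
theorem IsSpine.exists_contraction [Fintype V] [Fintype τ] {pos : V → V → P} {d : ℕ} {c : ℕ → V}
    {rank : V → ℕ} (hs : IsSpine pos d c rank) (tp : V → τ) (w : Fin m → V → V)
    (flip : P → P) (hflip : ∀ x y, pos y x = flip (pos x y))
    (hw : ∀ k a b, tp a = tp b → pos a (w k a) = pos b (w k b)) (hm : 1 ≤ m)
    (hd : 96 * m ^ 3 * Fintype.card τ ^ 3 < d) :
    ∃ i j, 2 ≤ i ∧ i < j ∧ j ≤ d ∧ ∃ π : V → V → V × V, tp (c i) = tp (c j) ∧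
      (∀ x y, π y x = (π x y).swap) ∧ (∀ x, π x x = (x, x)) ∧ (∀ x y, tp (π x y).1 = tp x) ∧
      (∀ x y, pos (π x y).1 (π x y).2 =
        pos (basePair rank i (c i) (c j) x y).1 (basePair rank i (c i) (c j) x y).2) ∧
      ∀ x, ¬ (i ≤ rank x ∧ rank x < j) → ∀ k, ∃ y, ¬ (i ≤ rank y ∧ rank y < j) ∧
        (π x y = (x, w k x) ∨ x = c j ∧ π x y = (c i, w k (c i))) := by
  classical
  obtain ⟨F, hFcard, hF1, hF⟩ := exists_repository tp c rank (2 * m)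
  set W1 := witnesses w F with hW1
  set W2 := witnesses w W1 with hW2
  set Q := F ∪ W1 ∪ W2 with hQ
  have hτ : 1 ≤ Fintype.card τ := Fintype.card_pos_iff.2 ⟨tp (c 0)⟩
  have hQcard : ((Q.image rank).card + 1) * (Fintype.card τ + 2) ≤ d := by
    set n := Fintype.card τ
    have h1 : Q.card ≤ F.card + W1.card + W2.card :=
      (Finset.card_union_le _ _).trans (Nat.add_le_add_right (Finset.card_union_le _ _) _)
    have h2 : W1.card ≤ F.card * m := card_witnesses_le w F
    have h3 : W2.card ≤ W1.card * m := card_witnesses_le w W1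
    have h4 : W2.card ≤ F.card * m * m := h3.trans (Nat.mul_le_mul_right _ h2)
    have h5 : (Q.image rank).card ≤ Q.card := Finset.card_image_le
    have h6 : F.card * m ≤ F.card * m * m := Nat.le_mul_of_pos_right _ hm
    have h7 : F.card ≤ F.card * m := Nat.le_mul_of_pos_right _ hm
    have h8 : F.card * m * m ≤ (4 * (2 * m) * n) * m * m := by gcongr
    have h9 : (Q.image rank).card + 1 ≤ 25 * (m ^ 3 * n) := by
      have : 1 ≤ m ^ 3 * n := Nat.mul_pos (pow_pos hm 3) hτ
      have e : (4 * (2 * m) * n) * m * m = 8 * (m ^ 3 * n) := by ring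
      rw [e] at h8
      omega
    -- `F`, its witnesses and their witnesses have at most `8 * m ^ 3 * n` elements each, so the
    -- first factor is at most `24 * m ^ 3 * n + 1`.
    calc ((Q.image rank).card + 1) * (n + 2) ≤ 25 * (m ^ 3 * n) * (3 * n) :=
          Nat.mul_le_mul h9 (by omega)
      _ = 75 * m ^ 3 * n ^ 2 := by ring
      _ ≤ 96 * m ^ 3 * n ^ 3 := by gcongr <;> omega
      _ ≤ d := hd.le
  obtain ⟨i, j, hi, hij, hjd, htij, hR⟩ :=
    exists_equal_types (fun l => tp (c l)) (Q.image rank) d hQcard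
  have hQR : ∀ q ∈ Q, rank q + 1 < i ∨ j < rank q := fun q hq =>
    hR _ (Finset.mem_image_of_mem _ hq)
  have hFR : ∀ f ∈ F, rank f + 1 < i ∨ j < rank f := fun f hf =>
    hQR f (Finset.mem_union_left _ (Finset.mem_union_left _ hf))
  have hru : rank (c i) = i := hs.rank_spine i (by omega) (by omega)
  have hrv : rank (c j) = j := hs.rank_spine j (by omega) (by omega)
  obtain ⟨π, p1, p2, p3, p4, p5, p6, p7⟩ := exists_redirect pos tp rank F w i j (c i) (c j)
    hrv hij flip hflip htij (by
      intro x hx k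
      apply hQR
      rcases hx with hx | hx
      · exact Finset.mem_union_left _ (Finset.mem_union_right _ (mem_witnesses w hx k))
      · exact Finset.mem_union_right _ (mem_witnesses w hx k))
  refine ⟨i, j, hi, hij, hjd, π, htij, p1, p2, p3, p4, fun x hx k => ?_⟩
  set b := w k x with hb
  -- Replacing the witness `b`.
  have replace : i ≤ rank b + 1 → rank b ≤ j →
      ((∀ f ∈ F, (b = c (rank b) ↔ f = c (rank f)) → j < rank f → pos x f = pos x b) ∨
        (∀ f ∈ F, (b = c (rank b) ↔ f = c (rank f)) → rank f + 1 < i → pos x f = pos x b)) →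
      ∃ y, ¬ (i ≤ rank y ∧ rank y < j) ∧
        (π x y = (x, b) ∨ x = c j ∧ π x y = (c i, w k (c i))) := by
    intro h1 h2 h3
    have hbF : b ∉ F := fun h => by have := hFR b h; omega
    -- Here `2 ≤ i` gives `rank b ≥ 1`. As `F` avoids the ranks in `[i - 1, j]`, elements of `G`,
    -- ranked no lower than `b`, lie beyond `j`, and those of `G'` lie below `i - 1`.
    obtain ⟨⟨G, hGF, hGs, hG⟩, ⟨G', hGF', hGs', hG'⟩⟩ := hF b hbF (by omega)
    have : 2 * m ≤ (candidates pos tp rank F i j x b).card := by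
      rcases h3 with h3 | h3
      · rw [← hGs]
        refine Finset.card_le_card fun f hf => Finset.mem_filter.2 ⟨hGF hf, hFR f (hGF hf),
          (hG f hf).1, h3 f (hGF hf) (hG f hf).2.1 ?_⟩
        have := hFR f (hGF hf)
        have := (hG f hf).2.2
        omega
      · rw [← hGs']
        refine Finset.card_le_card fun f hf => Finset.mem_filter.2 ⟨hGF' hf, hFR f (hGF' hf),
          (hG' f hf).1, h3 f (hGF' hf) (hG' f hf).2.1 ?_⟩
        have := hFR f (hGF' hf)
        have := (hG' f hf).2.2
        omega
    obtain ⟨y, hy, hy'⟩ := p5 x k h1 h2 this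
    exact ⟨y, by omega, Or.inl hy'⟩
  have keep : ¬ (i ≤ rank b ∧ rank b < j) → ¬ (rank x + 1 = i ∧ b = c j) →
      ¬ (rank b + 1 = i ∧ x = c j) → ∃ y, ¬ (i ≤ rank y ∧ rank y < j) ∧
        (π x y = (x, b) ∨ x = c j ∧ π x y = (c i, w k (c i))) := fun h1 h2 h3 =>
    ⟨b, h1, Or.inl (p6 x k (by simp only [basePair]; rw [if_neg h2, if_neg h3]))⟩
  by_cases hout : rank b + 1 < i ∨ j < rank b
  · refine keep (by omega) ?_ (by omega)
    rintro ⟨-, h⟩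
    rw [h, hrv] at hout
    omega
  by_cases hxi : rank x < i
  · by_cases hbi : rank b < i
    · refine keep (by omega) ?_ ?_
      · rintro ⟨-, h⟩
        rw [h, hrv] at hbi
        omega
      · rintro ⟨-, h⟩
        rw [h, hrv] at hxi
        omega
    · by_cases hbx : b = c (rank x + 1)
      · have h1 : rank b = rank x + 1 := by
          conv_lhs => rw [hbx]
          exact hs.rank_spine _ (by omega) (by omega)
        have h2 : rank x + 1 = i := by omega
        rw [h2] at hbx
        -- The lost witness is `c i` itself, and `c j` takes over its role for nodes of rank `i -
        -- 1`.
        refine ⟨c j, by omega, Or.inl ?_⟩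
        rw [p7 x (c j) (by omega) (by omega) (by omega) (by omega), basePair, if_pos ⟨h2, rfl⟩,
          hbx]
      · refine replace (by omega) (by omega) (Or.inl fun f hf hk hfj => ?_)
        refine hs.pos_above x f b (by omega) (by omega) ?_ hbx hk.symm
        intro e
        have h1 : rank f = rank x + 1 := by
          conv_lhs => rw [e]
          exact hs.rank_spine _ (by omega) (by omega)
        omega
  · by_cases hbj : rank b = j
    · refine keep (by omega) (by omega) (by omega)
    by_cases hxv : x = c j
    · by_cases hbj1 : rank b + 1 = j
      · rcases hs.pos_adjacent i j b hi hij hjd hbj1 with h | h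
        · refine replace (by omega) (by omega) (Or.inr fun f hf hk hfi => ?_)
          rw [hxv]
          exact (h f (hF1 f hf) (by omega) hk).symm
        -- Equal types put the witnesses of `c i` and `c j` in equal positions. Hence that of `c i`
        -- has rank `i - 1`, and `basePair` relates `c j` to it as `c i` was.
        · have h1 := h (w k (c i)) (by rw [hw k _ _ htij, hb, hxv])
          refine ⟨w k (c i), by omega, Or.inr ⟨hxv, ?_⟩⟩
          rw [p7 x _ (by omega) (by rw [hxv]; omega) (by omega) (by omega), basePair, if_neg,
            if_pos ⟨h1, hxv⟩]
          rintro ⟨h, -⟩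
          omega
      · refine replace (by omega) (by omega) (Or.inr fun f hf hk hfi => ?_)
        have : rank x = j := by rw [hxv, hrv]
        exact hs.pos_below x f b (hF1 f hf) (by omega) (by omega) (by omega)
          (fun _ => ⟨by omega, by omega⟩) hk.symm
    · refine replace (by omega) (by omega) (Or.inr fun f hf hk hfi => ?_)
      refine hs.pos_below x f b (hF1 f hf) (by omega) (by omega) (by omega) (fun e => ?_) hk.symm
      have : rank x ≠ j := fun h => hxv (by rw [e, h])
      omega

end Redirect

/-! ### Vertical case: subtree replacement and downward spines. -/

namespace IsOrderedTree

variable {T : Type} {child next : T → T → Prop}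

open Classical in
/-- Replacing the subtree of `u` by the subtree of a descendant `v` of `u`. -/
theorem exists_replace_subtree (h : IsOrderedTree child next) {u v : T} (huv : TransGen child u v)
    (hroot : ∃ p, child p u) (keep : T → Prop)
    (hkeep : ∀ x, keep x ↔ ¬ (ReflTransGen child u x ∧ ¬ ReflTransGen child v x)) :
    ∃ child' next' : {x // keep x} → {x // keep x} → Prop, IsOrderedTree child' next' ∧
      (∀ x y, ¬ ReflTransGen child u x.1 → y.1 = v →
        relPos child' next' x y = relPos child next x.1 u) ∧
      ∀ x y, ¬ (¬ ReflTransGen child u x.1 ∧ y.1 = v) → ¬ (¬ ReflTransGen child u y.1 ∧ x.1 = v) →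
        relPos child' next' x y = relPos child next x.1 y.1 := by
  have hirr := h.desc_irrefl
  have hvu : ¬ ReflTransGen child v u := fun hc => hirr _ (huv.trans_left hc)
  have huk : ¬ keep u := by rw [hkeep]; exact not_not.2 ⟨.refl, hvu⟩
  have hvk : keep v := by rw [hkeep]; exact fun hc => hc.2 .refl
  have huv' := huv.to_reflTransGen
  let ρ : {x // keep x} → T := fun x => if x.1 = v then u else x.1
  have ρv : ∀ x, x.1 = v → ρ x = u := fun x hx => if_pos hx
  have ρn : ∀ x, x.1 ≠ v → ρ x = x.1 := fun x hx => if_neg hx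
  have hcase : ∀ x : {x // keep x}, ¬ ReflTransGen child u x.1 ∨ ReflTransGen child v x.1 := by
    intro x
    have := (hkeep x.1).1 x.2
    tauto
  have ρinj : Function.Injective ρ := by
    intro x y hxy
    by_cases hx : x.1 = v <;> by_cases hy : y.1 = v
    · exact Subtype.ext (hx.trans hy.symm)
    · rw [ρv x hx, ρn y hy] at hxy
      exact absurd (hxy ▸ y.2) huk
    · rw [ρn x hx, ρv y hy] at hxy
      exact absurd (hxy ▸ x.2) huk
    · rw [ρn x hx, ρn y hy] at hxy
      exact Subtype.ext hxy
  -- Hung in the place of `u`, the node `v` receives the parent and both sibling neighbours of `u`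
  -- but keeps its own children. Hence `ρ` acts on one side of `child` and on both sides of `next`.
  let child' : {x // keep x} → {x // keep x} → Prop := fun a b => child a.1 (ρ b)
  let next' : {x // keep x} → {x // keep x} → Prop := fun a b => next (ρ a) (ρ b)
  -- the descendant relation
  have desc1 : ∀ a b, TransGen child' a b → TransGen child a.1 b.1 := by
    have step : ∀ a b, child' a b → TransGen child a.1 b.1 := by
      intro a b hab
      by_cases hb : b.1 = v
      · simp only [child', ρv b hb] at hab
        rw [hb]
        exact .head hab huv
      · simp only [child', ρn b hb] at hab
        exact .single hab
    intro a b hab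
    induction hab with
    | single hab => exact step _ _ hab
    | tail _ hbc ih => exact ih.trans (step _ _ hbc)
  have descA : ∀ a : {x // keep x}, ReflTransGen child v a.1 → ∀ b, TransGen child a.1 b →
      ∃ hb : keep b, TransGen child' a ⟨b, hb⟩ := by
    intro a ha b hab
    have kb : ∀ b, TransGen child a.1 b → keep b ∧ b ≠ v := by
      intro b hab
      refine ⟨(hkeep b).2 fun hc => hc.2 (ha.trans hab.to_reflTransGen), ?_⟩
      rintro rfl
      exact hirr _ (hab.trans_left ha)
    induction hab with
    | @single b hab =>
      obtain ⟨hb, hbv⟩ := kb b (.single hab)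
      exact ⟨hb, .single (by simpa only [child', ρn ⟨b, hb⟩ hbv] using hab)⟩
    | @tail y b hay hyb ih =>
      obtain ⟨hy, ih⟩ := ih
      obtain ⟨hb, hbv⟩ := kb b (hay.tail hyb)
      exact ⟨hb, ih.tail (by simpa only [child', ρn ⟨b, hb⟩ hbv] using hyb)⟩
  have descB : ∀ (a : {x // keep x}) b, TransGen child a.1 b → ¬ ReflTransGen child u b →
      ∃ hb : keep b, TransGen child' a ⟨b, hb⟩ := by
    intro a b hab hub
    have kb : ∀ b, ¬ ReflTransGen child u b → keep b ∧ b ≠ v := by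
      intro b hb
      refine ⟨(hkeep b).2 fun hc => hb hc.1, ?_⟩
      rintro rfl
      exact hb huv'
    induction hab with
    | @single b hab =>
      obtain ⟨hb, hbv⟩ := kb b hub
      exact ⟨hb, .single (by simpa only [child', ρn ⟨b, hb⟩ hbv] using hab)⟩
    | @tail y b hay hyb ih =>
      obtain ⟨hy, ih⟩ := ih fun hc => hub (hc.tail hyb)
      obtain ⟨hb, hbv⟩ := kb b hub
      exact ⟨hb, ih.tail (by simpa only [child', ρn ⟨b, hb⟩ hbv] using hyb)⟩
  have descu : ∀ a b, ¬ ReflTransGen child u a → ReflTransGen child u b → TransGen child a b →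
      TransGen child a u := by
    intro a b ha hb hab
    rcases h.le_total_of_le hab.to_reflTransGen hb with h1 | h1
    · rcases reflTransGen_iff_eq_or_transGen.1 h1 with e | h2
      · exact absurd (e ▸ .refl) ha
      · exact h2
    · exact absurd h1 ha
  have desc2 : ∀ a b : {x // keep x}, TransGen child a.1 b.1 → TransGen child' a b := by
    intro a b hab
    rcases hcase a with ha | ha
    · rcases hcase b with hb | hb
      · exact (descB a b hab hb).2
      · obtain ⟨p, hap, hpu⟩ := TransGen.tail'_iff.1 (descu a b ha (huv'.trans hb) hab)
        have hup : ¬ ReflTransGen child u p := fun hc => hirr _ (TransGen.tail' hc hpu)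
        have hpv : ∀ hp : keep p, child' ⟨p, hp⟩ ⟨v, hvk⟩ := fun hp => by
          simpa only [child', ρv ⟨v, hvk⟩ rfl] using hpu
        have hav : TransGen child' a ⟨v, hvk⟩ := by
          rcases reflTransGen_iff_eq_or_transGen.1 hap with e | h2
          · obtain ⟨a, ha'⟩ := a
            obtain rfl : p = a := e
            exact .single (hpv ha')
          · obtain ⟨hp, h3⟩ := descB a p h2 hup
            exact h3.tail (hpv hp)
        rcases reflTransGen_iff_eq_or_transGen.1 hb with e | h2
        · have e' : b = ⟨v, hvk⟩ := Subtype.ext e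
          rw [e']; exact hav
        · exact hav.trans (descA ⟨v, hvk⟩ .refl b h2).2
    · exact (descA a ha b hab).2
  have desc : ∀ a b : {x // keep x}, TransGen child' a b ↔ TransGen child a.1 b.1 := fun a b =>
    ⟨desc1 a b, desc2 a b⟩
  -- the sibling order
  have foll2 : ∀ (a : {x // keep x}) w, TransGen next (ρ a) w → ∃ b, ρ b = w ∧
      TransGen next' a b := by
    -- The image of `ρ` is closed under right siblings, so chains of `next` starting in it never
    -- pass through a deleted node.
    have closed : ∀ (a : {x // keep x}) z, next (ρ a) z → ∃ b, ρ b = z := by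
      intro a z haz
      obtain ⟨p, hpa, hpz⟩ := h.next_siblings _ _ haz
      by_cases hzu : z = u
      · exact ⟨⟨v, hvk⟩, (ρv ⟨v, hvk⟩ rfl).trans hzu.symm⟩
      have hlow : ReflTransGen child u p → ReflTransGen child v p := by
        intro hup
        have hau : ρ a ≠ u := fun e => hirr u (TransGen.tail' hup (e ▸ hpa))
        have hav : a.1 ≠ v := fun e => hau (ρv a e)
        rw [ρn a hav] at hpa hau
        rcases hcase a with ha | ha
        · exact absurd (hup.tail hpa) ha
        · exact h.le_parent ha hpa hav
      have hzv : z ≠ v := by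
        rintro rfl
        exact hirr z (TransGen.tail' (hlow (h.le_parent huv' hpz hzu)) hpz)
      have hz : keep z := (hkeep z).2 fun hc =>
        hc.2 ((hlow (h.le_parent hc.1 hpz hzu)).tail hpz)
      exact ⟨⟨z, hz⟩, ρn ⟨z, hz⟩ hzv⟩
    intro a w haw
    induction haw with
    | @single w haw =>
      obtain ⟨b, rfl⟩ := closed a w haw
      exact ⟨b, rfl, .single haw⟩
    | @tail y w _ hyw ih =>
      obtain ⟨b, rfl, ih⟩ := ih
      obtain ⟨c, rfl⟩ := closed b w hyw
      exact ⟨c, rfl, ih.tail hyw⟩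
  have foll : ∀ a b : {x // keep x}, TransGen next' a b ↔ TransGen next (ρ a) (ρ b) := by
    intro a b
    constructor
    · exact fun hab => hab.lift ρ fun _ _ => id
    · intro hab
      obtain ⟨c, hc, hac⟩ := foll2 a _ hab
      rwa [← ρinj hc]
  have htree : IsOrderedTree child' next' := by
    refine ⟨?_, ?_, ?_, ?_, ?_, ?_⟩
    · obtain ⟨r, hr, hreach⟩ := h.exists_root
      have hur : ¬ ReflTransGen child u r := by
        intro hc
        rcases ReflTransGen.cases_tail hc with e | ⟨p, -, hp⟩
        · obtain ⟨p, hp⟩ := hroot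
          exact hr p (e ▸ hp)
        · exact hr p hp
      have hrk : keep r := (hkeep r).2 fun hc => hur hc.1
      have hrv : r ≠ v := by rintro rfl; exact hur huv'
      refine ⟨⟨r, hrk⟩, fun p hp => ?_, fun w => ?_⟩
      · simp only [child', ρn ⟨r, hrk⟩ hrv] at hp
        exact hr _ hp
      · rcases reflTransGen_iff_eq_or_transGen.1 (hreach w.1) with e | h2
        · have : w = ⟨r, hrk⟩ := Subtype.ext e
          rw [this]
        · exact ((desc ⟨r, hrk⟩ w).2 h2).to_reflTransGen
    · exact fun p q w hp hq => Subtype.ext (h.parent_unique _ _ _ hp hq)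
    · intro a b hab
      obtain ⟨p, hpa, hpb⟩ := h.next_siblings _ _ hab
      have hp : keep p := by
        refine (hkeep p).2 fun hc => ?_
        have hau : ρ a ≠ u := fun e => hirr u (TransGen.tail' hc.1 (e ▸ hpa))
        have hav : a.1 ≠ v := fun e => hau (ρv a e)
        rw [ρn a hav] at hpa
        rcases hcase a with ha | ha
        · exact ha (hc.1.tail hpa)
        · exact hc.2 (h.le_parent ha hpa hav)
      exact ⟨⟨p, hp⟩, hpa, hpb⟩
    · exact fun a b c hb hc => ρinj (h.next_unique _ _ _ hb hc)
    · exact fun a ha => h.foll_irrefl _ ((foll a a).1 ha)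
    · intro p a b ha hb
      rw [foll, foll]
      exact (h.foll_total _ _ _ ha hb).imp_left fun e => ρinj e
  refine ⟨child', next', htree, ?_, ?_⟩
  · intro x y hx hy
    have hxv : x.1 ≠ v := fun e => hx (e ▸ huv')
    have hxu : x.1 ≠ u := fun e => hx (e ▸ .refl)
    have hvx : ¬ TransGen child v x.1 := fun hc => hx (huv'.trans hc.to_reflTransGen)
    have hux : ¬ TransGen child u x.1 := fun hc => hx hc.to_reflTransGen
    refine relPos_congr ⟨?_, ?_, ?_, ?_, ?_⟩ ⟨?_, ?_, ?_, ?_, ?_⟩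
    · exact iff_of_false (fun e => hxv (e ▸ hy)) hxu
    · simp only [child', ρv y hy]
    · rw [desc, hy]
      exact ⟨descu x.1 v hx huv', fun hc => hc.trans huv⟩
    · simp only [next', ρv y hy, ρn x hxv]
    · rw [foll, ρv y hy, ρn x hxv]
    · exact iff_of_false (fun e => hxv (e ▸ hy)) hxu.symm
    · simp only [child', ρn x hxv, hy]
      exact iff_of_false (fun hc => hvx (.single hc)) fun hc => hux (.single hc)
    · rw [desc, hy]
      exact iff_of_false hvx hux
    · simp only [next', ρv y hy, ρn x hxv]
    · rw [foll, ρv y hy, ρn x hxv]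
  · have main : ∀ x y : {x // keep x}, x.1 = v → ReflTransGen child u y.1 →
        relPos child' next' x y = relPos child next x.1 y.1 := by
      intro x y hx hy
      have hvy : ReflTransGen child v y.1 := (hcase y).resolve_left (not_not.2 hy)
      rcases reflTransGen_iff_eq_or_transGen.1 hvy with e | hvy
      · have : y = x := Subtype.ext (e.trans hx.symm)
        rw [this, relPos_self, relPos_self]
      · have hyv : y.1 ≠ v := fun e => hirr v (e ▸ hvy)
        have huy := huv.trans hvy
        have n1 := h.not_foll_of_desc hvy
        have n2 := h.not_foll_of_desc huy
        have hyv' : ¬ TransGen child y.1 v := fun hc => hirr _ (hvy.trans hc)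
        have hyu' : ¬ TransGen child y.1 u := fun hc => hirr _ (huy.trans hc)
        refine relPos_congr ⟨?_, ?_, desc _ _, ?_, ?_⟩ ⟨?_, ?_, desc _ _, ?_, ?_⟩
        · exact Subtype.ext_iff
        · simp only [child', ρn y hyv]
        · simp only [next', ρn y hyv, ρv x hx, hx]
          exact iff_of_false (fun hc => n2.1 (.single hc)) fun hc => n1.1 (.single hc)
        · rw [foll, ρn y hyv, ρv x hx, hx]
          exact iff_of_false n2.1 n1.1
        · exact Subtype.ext_iff
        · simp only [child', ρv x hx, hx]
          exact iff_of_false (fun hc => hyu' (.single hc)) fun hc => hyv' (.single hc)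
        · simp only [next', ρn y hyv, ρv x hx, hx]
          exact iff_of_false (fun hc => n2.2 (.single hc)) fun hc => n1.2 (.single hc)
        · rw [foll, ρn y hyv, ρv x hx, hx]
          exact iff_of_false n2.2 n1.2
    intro x y h1 h2
    by_cases hx : x.1 = v
    · exact main x y hx (by by_contra hc; exact h2 ⟨hc, hx⟩)
    · by_cases hy : y.1 = v
      · rw [htree.relPos_flip y x, h.relPos_flip y.1 x.1,
          main y x hy (by by_contra hc; exact h1 ⟨hc, hy⟩)]
      · refine relPos_congr ⟨Subtype.ext_iff, ?_, desc _ _, ?_, ?_⟩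
          ⟨Subtype.ext_iff, ?_, desc _ _, ?_, ?_⟩
        · simp only [child', ρn y hy]
        · simp only [next', ρn y hy, ρn x hx]
        · rw [foll, ρn y hy, ρn x hx]
        · simp only [child', ρn x hx]
        · simp only [next', ρn y hy, ρn x hx]
        · rw [foll, ρn y hy, ρn x hx]

section DownSpine

variable {d : ℕ} {c : ℕ → T} {rank : T → ℕ}

theorem desc_spine (hc : ∀ l, 1 ≤ l → l < d → child (c l) (c (l + 1))) {s t : ℕ} (hs : 1 ≤ s)
    (hst : s < t) (ht : t ≤ d) : TransGen child (c s) (c t) := by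
  induction t, hst using Nat.le_induction with
  | base => exact .single (hc s hs ht)
  | succ t hst ih => exact (ih (by omega)).tail (hc t (by omega) ht)

/-- The rank of `x` is the index of the lowest spine node above or equal to `x`. The alternative `l
= 0` in the search makes the rank `0` if there is none. -/
theorem exists_down_rank (hc : ∀ l, 1 ≤ l → l < d → child (c l) (c (l + 1))) :
    ∃ rank : T → ℕ, (∀ x, rank x ≤ d) ∧
      ∀ x l, 1 ≤ l → l ≤ d → (l ≤ rank x ↔ ReflTransGen child (c l) x) := by
  classical
  refine ⟨fun x => Nat.findGreatest (fun l => l = 0 ∨ ReflTransGen child (c l) x) d,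
    fun x => Nat.findGreatest_le d, fun x l hl hld => ⟨fun h => ?_, fun h => ?_⟩⟩
  · have h1 := Nat.findGreatest_spec (P := fun l => l = 0 ∨ ReflTransGen child (c l) x)
      (Nat.zero_le d) (Or.inl rfl)
    have h2 := Nat.findGreatest_le (P := fun l => l = 0 ∨ ReflTransGen child (c l) x) d
    simp only at h
    generalize Nat.findGreatest (fun l => l = 0 ∨ ReflTransGen child (c l) x) d = g at h h1 h2
    rcases h1 with rfl | h1
    · omega
    · rcases h.eq_or_lt with rfl | h
      · exact h1
      · exact (desc_spine hc hl h h2).to_reflTransGen.trans h1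
  · exact Nat.le_findGreatest hld (Or.inr h)

/-- A proper ancestor `b` of `c s` is comparable with `c (rank b + 1)`, hence strictly above it by
the definition of rank, hence at or above its parent `c (rank b)`, which is itself at or above `b`.
-/
theorem desc_spine_iff
    (h : IsOrderedTree child next)
    (hc : ∀ l, 1 ≤ l → l < d → child (c l) (c (l + 1)))
    (hrank : ∀ x l, 1 ≤ l → l ≤ d → (l ≤ rank x ↔ ReflTransGen child (c l) x))
    {b : T} {s : ℕ} (hb : 1 ≤ rank b) (hs : rank b < s) (hsd : s ≤ d) :
    TransGen child b (c s) ↔ b = c (rank b) := by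
  constructor
  · intro hbs
    have h1 : ReflTransGen child (c (rank b)) b := (hrank b _ hb (by omega)).1 le_rfl
    have h2 : ReflTransGen child (c (rank b + 1)) (c s) := by
      rcases (show rank b + 1 ≤ s by omega).eq_or_lt with e | hlt
      · rw [e]
      · exact (desc_spine hc (by omega) hlt hsd).to_reflTransGen
    have h3 : ¬ ReflTransGen child (c (rank b + 1)) b := fun h4 => by
      have := (hrank b _ (by omega) (by omega)).2 h4
      omega
    rcases h.le_total_of_le hbs.to_reflTransGen h2 with h4 | h4
    · refine h.le_antisymm (h.le_parent h4 (hc _ hb (by omega)) fun e => h3 ?_) h1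
      rw [e]
    · exact absurd h4 h3
  · intro e
    rw [e]
    exact desc_spine hc hb hs hsd

/-- A subtree is seen uniformly from outside, except at its root. Seen from a lower segment, a node
is an ancestor if it is on the spine and unrelated if it is off it. -/
theorem isSpine_down
    (h : IsOrderedTree child next)
    (hc : ∀ l, 1 ≤ l → l < d → child (c l) (c (l + 1)))
    (hrank : ∀ x l, 1 ≤ l → l ≤ d → (l ≤ rank x ↔ ReflTransGen child (c l) x))
    (hrd : ∀ x, rank x ≤ d) : IsSpine (relPos child next) d c rank := by
  classical
  have rank_spine : ∀ l, 1 ≤ l → l ≤ d → rank (c l) = l := by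
    intro l hl hld
    have h1 : l ≤ rank (c l) := (hrank _ _ hl hld).2 .refl
    rcases h1.eq_or_lt with e | hlt
    · exact e.symm
    · have h2 := (hrank (c l) (l + 1) (by omega) (hlt.trans_le (hrd _))).1 hlt
      exact absurd (TransGen.head' (hc l hl (hlt.trans_le (hrd _))) h2) (h.desc_irrefl _)
  have outside : ∀ x l, rank x < l → l ≤ d → ¬ ReflTransGen child (c l) x := by
    intro x l hx hl hcon
    have := (hrank x l (by omega) hl).2 hcon
    omega
  refine ⟨rank_spine, ?_, ?_, ?_⟩
  · intro x b f hb hf hbne hfne _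
    have := hrd b
    rw [h.relPos_of_subtree (outside x (rank x + 1) (by omega) (by omega))
        ((hrank b _ (by omega) (by omega)).1 hb) hbne,
      h.relPos_of_subtree (outside x (rank x + 1) (by omega) (by omega))
        ((hrank f _ (by omega) (by omega)).1 hf) hfne]
  · intro y b f hb1 hf1 hb hf hy hk
    have hyd := hrd y
    -- A subtree containing `y` but not rooted at `y`: if `y` is a spine node, the root must be one
    -- step higher, which explains the stronger rank hypothesis in that case.
    obtain ⟨s, hbs, hfs, hsy, hne⟩ : ∃ s, rank b < s ∧ rank f < s ∧ s ≤ rank y ∧ y ≠ c s := by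
      by_cases e : y = c (rank y)
      · obtain ⟨h1, h2⟩ := hy e
        refine ⟨rank y - 1, by omega, by omega, by omega, fun e' => ?_⟩
        have := rank_spine (rank y - 1) (by omega) (by omega)
        rw [← e'] at this
        omega
      · exact ⟨rank y, hb, hf, le_rfl, e⟩
    have hle := (hrank y s (by omega) (by omega)).1 hsy
    rw [h.relPos_flip b y, h.relPos_flip f y,
      h.relPos_of_subtree (outside b s hbs (by omega)) hle hne,
      h.relPos_of_subtree (outside f s hfs (by omega)) hle hne]
    simp only [h.desc_spine_iff hc hrank hb1 hbs (by omega),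
      h.desc_spine_iff hc hrank hf1 hfs (by omega), hk]
  · intro i j b hi hij hjd hbj
    have hrv := rank_spine j (by omega) hjd
    have hpu : child (c (i - 1)) (c i) := by
      have := hc (i - 1) (by omega) (by omega)
      rwa [show i - 1 + 1 = i by omega] at this
    have hpv : child (c (j - 1)) (c j) := by
      have := hc (j - 1) (by omega) (by omega)
      rwa [show j - 1 + 1 = j by omega] at this
    have hri := rank_spine (i - 1) (by omega) (by omega)
    by_cases hspine : b = c (rank b)
    · right
      intro b' hb'
      have hbv : child b (c j) := by rw [hspine, show rank b = j - 1 by omega]; exact hpv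
      have h1 := (h.navAgree_of_relPos_eq h (by
        rw [h.relPos_flip (c i) b', hb', ← h.relPos_flip] :
          relPos child next b' (c i) = relPos child next b (c j))).child_iff.2 hbv
      rw [h.parent_unique _ _ _ h1 hpu, hri]
      omega
    -- A sibling of `c j` is exceptional: a node in this position relative to `c i` is a child of `c
    -- (i - 1)` other than `c i`. If `b` is no sibling, its position is `free`, the generic one off
    -- the spine.
    · by_cases hsib : TransGen next (c j) b ∨ TransGen next b (c j)
      · right
        intro b' hb'
        have e' : relPos child next b' (c i) = relPos child next b (c j) := by
          rw [h.relPos_flip (c i) b', hb', ← h.relPos_flip]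
        have h1 : TransGen next (c i) b' ∨ TransGen next b' (c i) := hsib.imp
          (h.navAgree_of_relPos_eq h hb').foll_iff.2 (h.navAgree_of_relPos_eq h e').foll_iff.2
        have h2 : child (c (i - 1)) b' := by
          rcases h1 with h1 | h1
          · exact h.child_of_foll h1 hpu
          · exact h.child_of_foll' h1 hpu
        have h3 : i - 1 ≤ rank b' := (hrank _ _ (by omega) (by omega)).2 (.single h2)
        have h4 : ¬ i ≤ rank b' := by
          intro h4
          have h5 := (hrank _ _ (by omega) (by omega)).1 h4
          have h6 : b' ≠ c i := by
            rintro rfl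
            rcases h1 with h1 | h1 <;> exact h.foll_irrefl _ h1
          have h7 := h.le_parent h5 h2 h6
          exact h.desc_irrefl _ (TransGen.head' hpu h7)
        omega
      · left
        intro f hf hfj hk
        rw [not_or] at hsib
        have hvb : ¬ ReflTransGen child (c j) b := outside b j (by omega) hjd
        have hbv : ¬ TransGen child b (c j) := fun h1 =>
          hspine ((h.desc_spine_iff hc hrank (by omega) (by omega) hjd).1 h1)
        have e1 : relPos child next (c j) b = .free := by
          rw [← h.holds_iff]
          exact ⟨fun e => hvb (e ▸ .refl), fun h1 => hvb (.single h1), fun h1 => hbv (.single h1),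
            fun h1 => hvb h1.to_reflTransGen, hbv, fun h1 => hsib.1 (.single h1),
            fun h1 => hsib.2 (.single h1), hsib.1, hsib.2⟩
        have hne : c j ≠ c (j - 1) := fun e => h.desc_irrefl (c j) (.single (by
          nth_rewrite 1 [e]; exact hpv))
        have hnd : ¬ TransGen child f (c (j - 1)) := fun h1 =>
          hspine (hk.2 ((h.desc_spine_iff hc hrank hf (by omega) (by omega)).1 h1))
        rw [e1, h.relPos_flip f (c j), h.relPos_of_subtree (outside f (j - 1) (by omega) (by omega))
          (.single hpv) hne, if_neg hnd]
        rfl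

end DownSpine

end IsOrderedTree

/-! ### Horizontal case: rows of siblings. -/

namespace IsOrderedTree

variable {T : Type} {child next : T → T → Prop}

/-- The children of a node can be enumerated from left to right. -/
theorem exists_enum_children [Finite T] (h : IsOrderedTree child next) (p : T) :
    ∃ c : ℕ → T, (∀ x, child p x ↔ ∃ l, 1 ≤ l ∧ l ≤ Set.ncard {b | child p b} ∧ x = c l) ∧
      ∀ l, 1 ≤ l → l < Set.ncard {b | child p b} → next (c l) (c (l + 1)) := by
  classical
  have := Fintype.ofFinite T
  let S := {b // child p b}
  let ord : LinearOrder S :=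
    { le := fun a b => a = b ∨ TransGen next a.1 b.1
      le_refl := fun a => Or.inl rfl
      le_trans := by
        rintro a b e (rfl | h1) (rfl | h2)
        · exact Or.inl rfl
        · exact Or.inr h2
        · exact Or.inr h1
        · exact Or.inr (h1.trans h2)
      le_antisymm := by
        rintro a b (rfl | h1) (h2 | h2)
        · rfl
        · rfl
        · exact h2.symm
        · exact absurd (h1.trans h2) (h.foll_irrefl _)
      le_total := by
        intro a b
        rcases h.foll_total p a b a.2 b.2 with e | e | e
        · exact Or.inl (Or.inl (Subtype.ext e))
        · exact Or.inl (Or.inr e)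
        · exact Or.inr (Or.inr e)
      toDecidableLE := Classical.decRel _ }
  have hlt : ∀ a b : S, a < b → TransGen next a.1 b.1 := by
    intro a b hab
    rcases hab.le with e | h1
    · exact absurd e hab.ne
    · exact h1
  have hgt : ∀ a b : S, TransGen next a.1 b.1 → a < b := fun a b hab =>
    lt_of_le_of_ne (Or.inr hab) fun e => h.foll_irrefl b.1 (by rw [e] at hab; exact hab)
  set k := Set.ncard {b | child p b} with hk
  have hcard : Fintype.card S = k := by
    rw [hk, ← Nat.card_eq_fintype_card]
    rfl
  let e : Fin k ≃o S := Fintype.orderIsoFinOfCardEq S hcard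
  let c : ℕ → T := fun l => if hl : 1 ≤ l ∧ l ≤ k then (e ⟨l - 1, by omega⟩).1 else p
  have hce : ∀ l (h1 : 1 ≤ l) (h2 : l ≤ k), c l = (e ⟨l - 1, by omega⟩).1 := fun l h1 h2 =>
    dif_pos ⟨h1, h2⟩
  refine ⟨c, fun x => ⟨fun hx => ?_, ?_⟩, fun l hl hlk => ?_⟩
  · have hx' := (e.symm ⟨x, hx⟩).2
    refine ⟨(e.symm ⟨x, hx⟩).1 + 1, by omega, hx', ?_⟩
    rw [hce _ (by omega) hx']
    simp
  · rintro ⟨l, h1, h2, rfl⟩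
    rw [hce l h1 h2]
    exact (e _).2
  · rw [hce l hl hlk.le, hce (l + 1) (by omega) hlk]
    have h1 : e ⟨l - 1, by omega⟩ < e ⟨l + 1 - 1, by omega⟩ :=
      e.strictMono (Fin.mk_lt_mk.2 (by omega))
    -- The first `next` step lands on the following child, since the order isomorphism leaves no
    -- room strictly between consecutive indices.
    obtain ⟨z, hz, hz'⟩ := TransGen.head'_iff.1 (hlt _ _ h1)
    have hpz : child p z := h.child_of_foll (.single hz) (e _).2
    rcases reflTransGen_iff_eq_or_transGen.1 hz' with e' | h2
    · rwa [e']
    · have h3 : e ⟨l - 1, by omega⟩ < ⟨z, hpz⟩ := hgt _ _ (.single hz)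
      have h4 : ⟨z, hpz⟩ < e ⟨l + 1 - 1, by omega⟩ := hgt _ _ h2
      rw [← e.apply_symm_apply ⟨z, hpz⟩, e.lt_iff_lt, Fin.lt_def] at h3 h4
      simp only at h3 h4
      omega

section RightSpine

variable {d : ℕ} {c : ℕ → T} {p : T}

theorem foll_spine (hnext : ∀ l, 1 ≤ l → l < d → next (c l) (c (l + 1))) {s t : ℕ} (hs : 1 ≤ s)
    (hst : s < t) (ht : t ≤ d) : TransGen next (c s) (c t) := by
  induction t, hst using Nat.le_induction with
  | base => exact .single (hnext s hs ht)
  | succ t hst ih => exact (ih (by omega)).tail (hnext t (by omega) ht)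

/-- The rank is the index of the child of `p` whose subtree contains `x`, unique because subtrees of
siblings are disjoint; outside these subtrees it is `0`. -/
theorem exists_right_rank (h : IsOrderedTree child next)
    (hchild : ∀ x, child p x ↔ ∃ l, 1 ≤ l ∧ l ≤ d ∧ x = c l)
    (hnext : ∀ l, 1 ≤ l → l < d → next (c l) (c (l + 1))) :
    ∃ rank : T → ℕ, (∀ x, rank x ≤ d) ∧
      ∀ x l, 1 ≤ l → l ≤ d → (rank x = l ↔ ReflTransGen child (c l) x) := by
  classical
  have key : ∀ x l t, 1 ≤ l → l ≤ d → 1 ≤ t → t ≤ d → ReflTransGen child (c l) x →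
      ReflTransGen child (c t) x → l = t := by
    have aux : ∀ l t, 1 ≤ l → l ≤ d → 1 ≤ t → t ≤ d → ReflTransGen child (c l) (c t) → l = t := by
      intro l t hl hld ht htd hlt
      have h1 := (hchild (c l)).2 ⟨l, hl, hld, rfl⟩
      have h2 := (hchild (c t)).2 ⟨t, ht, htd, rfl⟩
      have h3 : c t = c l := by
        by_contra hne
        exact h.desc_irrefl p (TransGen.head' h1 (h.le_parent hlt h2 hne))
      rcases lt_trichotomy l t with hh | hh | hh
      · exact absurd (foll_spine hnext hl hh htd) (by rw [h3]; exact h.foll_irrefl _)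
      · exact hh
      · exact absurd (foll_spine hnext ht hh hld) (by rw [h3]; exact h.foll_irrefl _)
    intro x l t hl hld ht htd h1 h2
    rcases h.le_total_of_le h1 h2 with h3 | h3
    · exact aux l t hl hld ht htd h3
    · exact (aux t l ht htd hl hld h3).symm
  have hex : ∀ x, ∃ r ≤ d, ∀ l, 1 ≤ l → l ≤ d → (r = l ↔ ReflTransGen child (c l) x) := by
    intro x
    by_cases hx : ∃ l, 1 ≤ l ∧ l ≤ d ∧ ReflTransGen child (c l) x
    · obtain ⟨l, h1, h2, h3⟩ := hx
      exact ⟨l, h2, fun t ht htd => ⟨fun e => e ▸ h3, fun h4 => key x l t h1 h2 ht htd h3 h4⟩⟩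
    · exact ⟨0, Nat.zero_le _, fun t ht htd =>
        ⟨fun e => by omega, fun h4 => absurd ⟨t, ht, htd, h4⟩ hx⟩⟩
  choose rank h1 h2 using hex
  exact ⟨rank, h1, h2⟩

variable {rank : T → ℕ}

theorem rank_right_spine
    (hrank : ∀ x l, 1 ≤ l → l ≤ d → (rank x = l ↔ ReflTransGen child (c l) x)) :
    ∀ l, 1 ≤ l → l ≤ d → rank (c l) = l := fun _ hl hld => (hrank _ _ hl hld).2 .refl

theorem not_next_spine (h : IsOrderedTree child next)
    (hnext : ∀ l, 1 ≤ l → l < d → next (c l) (c (l + 1))) {s t : ℕ} (hs : 1 ≤ s)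
    (hst : s + 1 < t) (htd : t ≤ d) :
    ¬ next (c s) (c t) := by
  intro hn
  have e := h.next_unique _ _ _ hn (hnext s hs (by omega))
  have := foll_spine hnext (by omega) hst htd
  rw [e] at this
  exact h.foll_irrefl _ this

theorem relPos_spine_right (h : IsOrderedTree child next)
    (hnext : ∀ l, 1 ≤ l → l < d → next (c l) (c (l + 1))) {s t : ℕ} (hs : 1 ≤ s)
    (hst : s + 1 < t) (htd : t ≤ d) :
    relPos child next (c s) (c t) = .rightRight :=
  h.holds_iff.1 ⟨foll_spine hnext hs (by omega) htd, h.not_next_spine hnext hs hst htd⟩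

theorem desc_right_spine_iff
    (h : IsOrderedTree child next)
    (hchild : ∀ x, child p x ↔ ∃ l, 1 ≤ l ∧ l ≤ d ∧ x = c l)
    {l : ℕ} (hl : 1 ≤ l) (hld : l ≤ d) (x : T) :
    TransGen child x (c l) ↔ ReflTransGen child x p := by
  have hp := (hchild (c l)).2 ⟨l, hl, hld, rfl⟩
  constructor
  · intro hx
    obtain ⟨q, hxq, hq⟩ := TransGen.tail'_iff.1 hx
    rwa [h.parent_unique _ _ _ hp hq]
  · exact fun hx => TransGen.tail' hx hp

theorem rank_eq_zero_of_le
    (h : IsOrderedTree child next)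
    (hchild : ∀ x, child p x ↔ ∃ l, 1 ≤ l ∧ l ≤ d ∧ x = c l)
    (hrank : ∀ x l, 1 ≤ l → l ≤ d → (rank x = l ↔ ReflTransGen child (c l) x))
    {x : T} (hxd : rank x ≤ d) (hx : ReflTransGen child x p) :
    rank x = 0 := by
  by_contra hne
  have h1 := (hrank x _ (by omega) hxd).1 rfl
  have h2 := (hchild (c (rank x))).2 ⟨_, by omega, hxd, rfl⟩
  exact h.desc_irrefl p (TransGen.head' h2 (h1.trans hx))

open Classical in
theorem relPos_off_spine
    (h : IsOrderedTree child next)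
    (hchild : ∀ x, child p x ↔ ∃ l, 1 ≤ l ∧ l ≤ d ∧ x = c l)
    (hrank : ∀ x l, 1 ≤ l → l ≤ d → (rank x = l ↔ ReflTransGen child (c l) x))
    (hrd : ∀ x, rank x ≤ d)
    {x b : T} (hb : 1 ≤ rank b) (hx : rank x ≠ rank b)
    (hne : b ≠ c (rank b)) :
    relPos child next x b = if ReflTransGen child x p then .downDown else .free := by
  rw [h.relPos_of_subtree (z := c (rank b)) (fun hc => hx ((hrank x _ hb (hrd b)).2 hc))
    ((hrank b _ hb (hrd b)).1 rfl) hne]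
  simp only [h.desc_right_spine_iff hchild hb (hrd b)]

open Classical in
theorem relPos_to_spine
    (h : IsOrderedTree child next)
    (hchild : ∀ x, child p x ↔ ∃ l, 1 ≤ l ∧ l ≤ d ∧ x = c l)
    (hrank : ∀ x l, 1 ≤ l → l ≤ d → (rank x = l ↔ ReflTransGen child (c l) x))
    (hrd : ∀ x, rank x ≤ d)
    {x : T} {t : ℕ} (ht : 1 ≤ t) (htd : t ≤ d) (hx : rank x ≠ t)
    (hne : rank x = 0 ∨ x ≠ c (rank x)) :
    relPos child next x (c t) = if x = p then .down else
      if ReflTransGen child x p then .downDown else .free := by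
  have hrt := rank_right_spine hrank t ht htd
  have hp := (hchild (c t)).2 ⟨t, ht, htd, rfl⟩
  by_cases hx0 : rank x = 0
  · split_ifs with h1 h2
    · rw [h1]; exact h.holds_iff.1 hp
    · exact h.holds_iff.1 ⟨(h.desc_right_spine_iff hchild ht htd x).2 h2, fun hc =>
        h1 (h.parent_unique _ _ _ hc hp)⟩
    · have hup : ¬ ReflTransGen child (c t) x := fun hc => hx ((hrank x t ht htd).2 hc)
      have hdn : ¬ TransGen child x (c t) := fun hc =>
        h2 ((h.desc_right_spine_iff hchild ht htd x).1 hc)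
      have hxp : ¬ child p x := by
        intro hc
        obtain ⟨l, hl, hld, rfl⟩ := (hchild x).1 hc
        rw [rank_right_spine hrank l hl hld] at hx0
        omega
      have hf : ¬ TransGen next x (c t) := fun hc => hxp (h.child_of_foll' hc hp)
      have hf' : ¬ TransGen next (c t) x := fun hc => hxp (h.child_of_foll hc hp)
      exact h.holds_iff.1 ⟨fun e => hup (e ▸ .refl), fun hc => hdn (.single hc),
        fun hc => hup (.single hc), hdn, fun hc => hup hc.to_reflTransGen,
        fun hc => hf (.single hc), fun hc => hf' (.single hc), hf, hf'⟩
  · have hnp : ¬ ReflTransGen child x p := fun hc =>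
      hx0 (h.rank_eq_zero_of_le hchild hrank (hrd x) hc)
    have hctp : ¬ ReflTransGen child (c t) p := fun hc => h.desc_irrefl p (TransGen.head' hp hc)
    have hxne : x ≠ p := fun e => hnp (e ▸ .refl)
    rw [h.relPos_flip (c t) x, h.relPos_off_spine hchild hrank hrd (by omega)
      (by rw [hrt]; exact hx.symm) (hne.resolve_left hx0), if_neg hctp, if_neg hxne, if_neg hnp]
    rfl

theorem exists_of_spine_foll
    (h : IsOrderedTree child next)
    (hchild : ∀ x, child p x ↔ ∃ l, 1 ≤ l ∧ l ≤ d ∧ x = c l)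
    (hnext : ∀ l, 1 ≤ l → l < d → next (c l) (c (l + 1)))
    {l : ℕ} (hl : 1 ≤ l) (hld : l ≤ d) {x : T}
    (hx : TransGen next (c l) x) : ∃ t, l < t ∧ t ≤ d ∧ x = c t := by
  obtain ⟨t, ht, htd, rfl⟩ := (hchild x).1 (h.child_of_foll hx ((hchild _).2 ⟨l, hl, hld, rfl⟩))
  refine ⟨t, ?_, htd, rfl⟩
  by_contra hcon
  rcases (not_lt.1 hcon).eq_or_lt with rfl | hlt
  · exact h.foll_irrefl _ hx
  · exact h.foll_irrefl _ (hx.trans (foll_spine hnext ht hlt hld))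

theorem exists_of_foll_spine
    (h : IsOrderedTree child next)
    (hchild : ∀ x, child p x ↔ ∃ l, 1 ≤ l ∧ l ≤ d ∧ x = c l)
    (hnext : ∀ l, 1 ≤ l → l < d → next (c l) (c (l + 1)))
    {l : ℕ} (hl : 1 ≤ l) (hld : l ≤ d) {x : T}
    (hx : TransGen next x (c l)) : ∃ t, 1 ≤ t ∧ t < l ∧ x = c t := by
  obtain ⟨t, ht, htd, rfl⟩ := (hchild x).1 (h.child_of_foll' hx ((hchild _).2 ⟨l, hl, hld, rfl⟩))
  refine ⟨t, ht, ?_, rfl⟩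
  by_contra hcon
  rcases (not_lt.1 hcon).eq_or_lt with rfl | hlt
  · exact h.foll_irrefl _ hx
  · exact h.foll_irrefl _ (hx.trans (foll_spine hnext hl hlt htd))

/-- Seen from another segment, nodes off the spine are either proper descendants (but not children)
or unrelated, according to whether the observer is at or above `p`. Spine nodes look alike unless
the observer is also one; then only direct neighbours stand out, and these the axioms exempt. -/
theorem isSpine_right
    (h : IsOrderedTree child next)
    (hchild : ∀ x, child p x ↔ ∃ l, 1 ≤ l ∧ l ≤ d ∧ x = c l)
    (hrank : ∀ x l, 1 ≤ l → l ≤ d → (rank x = l ↔ ReflTransGen child (c l) x))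
    (hrd : ∀ x, rank x ≤ d)
    (hnext : ∀ l, 1 ≤ l → l < d → next (c l) (c (l + 1))) :
    IsSpine (relPos child next) d c rank := by
  classical
  have rank_spine := rank_right_spine hrank
  have off := @relPos_off_spine _ _ _ _ _ _ _ h hchild hrank hrd
  have on := @relPos_to_spine _ _ _ _ _ _ _ h hchild hrank hrd
  have notle : ∀ x, 1 ≤ rank x → ¬ ReflTransGen child x p := fun x hx hc => by
    have := h.rank_eq_zero_of_le hchild hrank (hrd x) hc
    omega
  refine ⟨rank_spine, ?_, ?_, ?_⟩
  · intro x b f hb hf hbne hfne hk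
    by_cases hspine : b = c (rank b)
    · have hspine' := hk.1 hspine
      by_cases hx : rank x = 0 ∨ x ≠ c (rank x)
      · rw [hspine, hspine', on (by omega) (hrd b) hb.ne hx, on (by omega) (hrd f) hf.ne hx]
      · rw [not_or, not_not] at hx
        have hb2 : rank x + 1 ≠ rank b := fun e => hbne (e ▸ hspine)
        have hf2 : rank x + 1 ≠ rank f := fun e => hfne (e ▸ hspine')
        rw [hspine, hspine', hx.2,
          h.relPos_spine_right hnext (by omega) (by omega) (hrd b),
          h.relPos_spine_right hnext (by omega) (by omega) (hrd f)]
    · rw [off (by omega) hb.ne hspine, off (by omega) hf.ne (fun e => hspine (hk.2 e))]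
  · intro y b f hb1 hf1 hb hf hy hk
    by_cases hspine : b = c (rank b)
    · have hspine' := hk.1 hspine
      by_cases hys : y = c (rank y)
      · obtain ⟨h1, h2⟩ := hy hys
        rw [h.relPos_flip b y, h.relPos_flip f y, hspine, hspine', hys,
          h.relPos_spine_right hnext hb1 h1 (hrd y),
          h.relPos_spine_right hnext hf1 h2 (hrd y)]
      · rw [hspine, hspine', on hb1 (hrd b) hb.ne' (Or.inr hys), on hf1 (hrd f) hf.ne' (Or.inr hys)]
    · rw [off hb1 hb.ne' hspine, off hf1 hf.ne' (fun e => hspine (hk.2 e))]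
  · intro i j b hi hij hjd hbj
    have hrj := rank_spine j (by omega) hjd
    by_cases hspine : b = c (rank b)
    · right
      intro b' hb'
      have h1 := hnext (rank b) (by omega) (by omega)
      rw [hbj, ← hspine] at h1
      have h2 := (h.navAgree_of_relPos_eq h (by
        rw [h.relPos_flip (c i) b', hb', ← h.relPos_flip] :
          relPos child next b' (c i) = relPos child next b (c j))).next_iff.2 h1
      have h3 := hnext (i - 1) (by omega) (by omega)
      rw [show i - 1 + 1 = i by omega] at h3
      rw [h.next_unique_left h2 h3, rank_spine (i - 1) (by omega) (by omega)]
      omega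
    · left
      intro f hf hfj hk
      rw [off (by omega) (by omega) hspine, off hf (by omega) (fun e => hspine (hk.2 e))]

/-- Removing the subtrees of consecutive siblings. -/
theorem exists_remove_siblings
    (h : IsOrderedTree child next)
    (hchild : ∀ x, child p x ↔ ∃ l, 1 ≤ l ∧ l ≤ d ∧ x = c l)
    (hrank : ∀ x l, 1 ≤ l → l ≤ d → (rank x = l ↔ ReflTransGen child (c l) x))
    (hrd : ∀ x, rank x ≤ d)
    (hnext : ∀ l, 1 ≤ l → l < d → next (c l) (c (l + 1)))
    {i j : ℕ} (hi : 2 ≤ i) (hij : i < j) (hjd : j ≤ d) :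
    ∃ child' next' : {x // ¬ (i ≤ rank x ∧ rank x < j)} →
        {x // ¬ (i ≤ rank x ∧ rank x < j)} → Prop,
      IsOrderedTree child' next' ∧
      (∀ x y, rank x.1 < i → y.1 = c j → relPos child' next' x y = relPos child next x.1 (c i)) ∧
      ∀ x y, ¬ (rank x.1 < i ∧ y.1 = c j) → ¬ (rank y.1 < i ∧ x.1 = c j) →
        relPos child' next' x y = relPos child next x.1 y.1 := by
  classical
  have rank_spine := rank_right_spine hrank
  have hru := rank_spine i (by omega) (by omega)
  have hrv := rank_spine j (by omega) (by omega)
  have hpu := (hchild (c i)).2 ⟨i, by omega, by omega, rfl⟩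
  have hpv := (hchild (c j)).2 ⟨j, by omega, by omega, rfl⟩
  let keep : T → Prop := fun x => ¬ (i ≤ rank x ∧ rank x < j)
  let ρ : T → T := fun x => if x = c j then c i else x
  have ρv : ∀ x, x = c j → ρ x = c i := fun x hx => if_pos hx
  have ρn : ∀ x, x ≠ c j → ρ x = x := fun x hx => if_neg hx
  have hvk : keep (c j) := fun hc => by omega
  have hnu : ∀ x : {x // keep x}, x.1 ≠ c i := fun x hx => x.2 (by rw [hx]; omega)
  have ρinj : ∀ a b : {x // keep x}, ρ a.1 = ρ b.1 → a = b := by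
    intro x y hxy
    by_cases hx : x.1 = c j <;> by_cases hy : y.1 = c j
    · exact Subtype.ext (hx.trans hy.symm)
    · rw [ρv x hx, ρn y hy] at hxy
      exact absurd hxy.symm (hnu y)
    · rw [ρn x hx, ρv y hy] at hxy
      exact absurd hxy (hnu x)
    · rw [ρn x hx, ρn y hy] at hxy
      exact Subtype.ext hxy
  let child' : {x // keep x} → {x // keep x} → Prop := fun a b => child a.1 b.1
  -- Only the second argument is changed: `c j` inherits the left neighbour of `c i` and keeps its
  -- own right neighbour.
  let next' : {x // keep x} → {x // keep x} → Prop := fun a b => next a.1 (ρ b.1)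
  have closed : ∀ a b, child a b → keep b → keep a := by
    intro a b hab hb ha
    have h1 := (hrank a (rank a) (by omega) (hrd a)).1 rfl
    have h2 := (hrank b (rank a) (by omega) (hrd a)).2 (h1.tail hab)
    exact hb (by omega)
  have desc : ∀ a b : {x // keep x}, TransGen child' a b ↔ TransGen child a.1 b.1 := by
    intro a b
    constructor
    · exact fun hab => hab.lift Subtype.val fun _ _ => id
    · have key : ∀ w, TransGen child a.1 w → ∀ hw : keep w, TransGen child' a ⟨w, hw⟩ := by
        intro w haw
        induction haw with
        | single haw => exact fun hw => .single haw
        | @tail y w _ hyw ih => exact fun hw => (ih (closed _ _ hyw hw)).tail hyw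
      exact fun hab => key b.1 hab b.2
  have foll : ∀ a b : {x // keep x}, TransGen next' a b ↔ TransGen next a.1 b.1 := by
    have step : ∀ a b, next' a b → TransGen next a.1 b.1 := by
      intro a b hab
      by_cases hb : b.1 = c j
      · simp only [next', ρv _ hb] at hab
        rw [hb]
        exact .head hab (foll_spine hnext (by omega) hij hjd)
      · simp only [next', ρn _ hb] at hab
        exact .single hab
    intro a b
    constructor
    · intro hab
      induction hab with
      | single hab => exact step _ _ hab
      | tail _ hbc ih => exact ih.trans (step _ _ hbc)
    · intro hab
      obtain ⟨q, hqa, hqb⟩ := h.foll_siblings hab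
      by_cases hq : q = p
      · subst hq
        obtain ⟨s, hs, hsd, has⟩ := (hchild a.1).1 hqa
        have hak : ¬ (i ≤ s ∧ s < j) := fun hc =>
          a.2 (by rw [has, rank_spine s hs hsd]; exact hc)
        have key : ∀ t, s < t → t ≤ d → ∀ ht : keep (c t), TransGen next' a ⟨c t, ht⟩ := by
          intro t
          induction t using Nat.strong_induction_on with
          | _ t ih =>
            intro hst htd ht
            have htk : ¬ (i ≤ t ∧ t < j) := by
              simpa only [keep, rank_spine t (by omega) htd] using ht
            have keep_of : ∀ l, 1 ≤ l → l ≤ d → ¬ (i ≤ l ∧ l < j) → keep (c l) := by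
              intro l h1 h2 h3
              simpa only [keep, rank_spine l h1 h2] using h3
            -- The preceding surviving sibling: index `i - 1` for `t = j`, and `t - 1` otherwise.
            obtain ⟨l, hsl, hlt, hlk, hln⟩ : ∃ l, s ≤ l ∧ l < t ∧ ¬ (i ≤ l ∧ l < j) ∧
                next (c l) (ρ (c t)) := by
              by_cases htj : t = j
              · refine ⟨i - 1, by omega, by omega, by omega, ?_⟩
                rw [ρv (c t) (by rw [htj])]
                have := hnext (i - 1) (by omega) (by omega)
                rwa [show i - 1 + 1 = i by omega] at this
              · refine ⟨t - 1, by omega, by omega, by omega, ?_⟩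
                have hne : c t ≠ c j := fun e => htj (by
                  rw [← rank_spine t (by omega) htd, e, hrv])
                rw [ρn _ hne]
                have := hnext (t - 1) (by omega) (by omega)
                rwa [show t - 1 + 1 = t by omega] at this
            rcases hsl.eq_or_lt with rfl | hsl
            · refine .single ?_
              simp only [next', has]
              exact hln
            · exact (ih l hlt hsl (by omega) (keep_of l (by omega) (by omega) hlk)).tail hln
        obtain ⟨t, ht, htd, hbt⟩ := (hchild b.1).1 hqb
        have hst : s < t := by
          rw [has, hbt] at hab
          obtain ⟨t', h1, h2, h3⟩ := h.exists_of_spine_foll hchild hnext hs hsd hab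
          have : t = t' := by rw [← rank_spine t ht htd, h3, rank_spine t' (by omega) h2]
          omega
        have hbk : keep (c t) := hbt ▸ b.2
        have : b = ⟨c t, hbk⟩ := Subtype.ext hbt
        rw [this]
        exact key t hst htd hbk
      · have hkq : ∀ z, child q z → keep z ∧ z ≠ c j := by
          have hne : ∀ z, child q z → ∀ l, 1 ≤ l → l ≤ d → z ≠ c l := by
            rintro z hz l hl hld rfl
            exact hq (h.parent_unique _ _ _ hz ((hchild _).2 ⟨l, hl, hld, rfl⟩))
          intro z hz
          refine ⟨fun hzk => ?_, hne z hz j (by omega) hjd⟩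
          have h1 := (hrank z (rank z) (by omega) (hrd z)).1 rfl
          have h2 := h.le_parent h1 hz (hne z hz _ (by omega) (hrd z))
          have h3 := (hrank a.1 (rank z) (by omega) (hrd z)).2 (h2.tail hqa)
          exact a.2 (by omega)
        have key : ∀ w, TransGen next a.1 w → ∃ hw : keep w, TransGen next' a ⟨w, hw⟩ := by
          intro w haw
          induction haw with
          | @single w haw =>
            obtain ⟨h1, h2⟩ := hkq w (h.child_of_foll (.single haw) hqa)
            exact ⟨h1, .single (by simpa only [next', ρn w h2] using haw)⟩
          | @tail y w hay hyw ih =>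
            obtain ⟨h1, h2⟩ := hkq w (h.child_of_foll (hay.tail hyw) hqa)
            obtain ⟨hy, ih⟩ := ih
            exact ⟨h1, ih.tail (by simpa only [next', ρn w h2] using hyw)⟩
        exact (key b.1 hab).2
  have htree : IsOrderedTree child' next' := by
    refine ⟨?_, ?_, ?_, ?_, ?_, ?_⟩
    · obtain ⟨r, hr, hreach⟩ := h.exists_root
      have hrk : keep r := by
        intro hc
        have h1 := (hrank r (rank r) (by omega) (hrd r)).1 rfl
        rcases ReflTransGen.cases_tail h1 with e | ⟨q, -, hq⟩
        · have := (hchild (c (rank r))).2 ⟨_, by omega, hrd r, rfl⟩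
          rw [← e] at this
          exact hr p this
        · exact hr q hq
      refine ⟨⟨r, hrk⟩, fun p hp => hr _ hp, fun w => ?_⟩
      rcases reflTransGen_iff_eq_or_transGen.1 (hreach w.1) with e | h2
      · have : w = ⟨r, hrk⟩ := Subtype.ext e
        rw [this]
      · exact ((desc ⟨r, hrk⟩ w).2 h2).to_reflTransGen
    · exact fun p q w hp hq => Subtype.ext (h.parent_unique _ _ _ hp hq)
    · intro a b hab
      obtain ⟨q, hqa, hqb⟩ := h.foll_siblings ((foll a b).1 (.single hab))
      exact ⟨⟨q, closed _ _ hqa a.2⟩, hqa, hqb⟩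
    · exact fun a b c hb hc => ρinj _ _ (h.next_unique _ _ _ hb hc)
    · exact fun a ha => h.foll_irrefl _ ((foll a a).1 ha)
    · intro p a b ha hb
      rw [foll, foll]
      exact (h.foll_total _ _ _ ha hb).imp_left Subtype.ext
  have out : ∀ x l, 1 ≤ l → l ≤ d → rank x ≠ l → ¬ ReflTransGen child (c l) x :=
    fun x l hl hld hx hc => hx ((hrank x l hl hld).2 hc)
  have foll_rank : ∀ x l, 1 ≤ l → l ≤ d → rank x < l → ¬ TransGen next (c l) x := by
    intro x l hl hld hx hc
    obtain ⟨t, h1, h2, rfl⟩ := h.exists_of_spine_foll hchild hnext hl hld hc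
    rw [rank_spine t (by omega) h2] at hx
    omega
  have foll_rank' : ∀ x l, 1 ≤ l → l ≤ d → l ≤ rank x → ¬ TransGen next x (c l) := by
    intro x l hl hld hx hc
    obtain ⟨t, h1, h2, rfl⟩ := h.exists_of_foll_spine hchild hnext hl hld hc
    rw [rank_spine t (by omega) (by omega)] at hx
    omega
  refine ⟨child', next', htree, ?_, ?_⟩
  · intro x y hx hy
    have hxv : x.1 ≠ c j := fun e => by rw [e] at hx; omega
    have hvx := out x.1 j (by omega) hjd (by omega)
    have hux := out x.1 i (by omega) (by omega) (by omega)
    refine relPos_congr ⟨?_, ?_, ?_, ?_, ?_⟩ ⟨?_, ?_, ?_, ?_, ?_⟩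
    · exact iff_of_false (fun e => hxv (e ▸ hy)) (hnu x)
    · simp only [child', hy]
      exact ⟨fun hc => h.parent_unique _ _ _ hpv hc ▸ hpu,
        fun hc => h.parent_unique _ _ _ hpu hc ▸ hpv⟩
    · rw [desc, hy, h.desc_right_spine_iff hchild (by omega) hjd,
        h.desc_right_spine_iff hchild (by omega) (by omega)]
    · simp only [next', ρv _ hy]
    · rw [foll, hy]
      constructor
      · intro hc
        obtain ⟨t, h1, h2, h3⟩ := h.exists_of_foll_spine hchild hnext (by omega) hjd hc
        rw [h3, rank_spine t h1 (by omega)] at hx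
        rw [h3]
        exact foll_spine hnext h1 hx (by omega)
      · exact fun hc => hc.trans (foll_spine hnext (by omega) hij hjd)
    · exact iff_of_false (fun e => hxv (e ▸ hy)) (hnu x).symm
    · simp only [child', hy]
      exact iff_of_false (fun hc => hvx (.single hc)) fun hc => hux (.single hc)
    · rw [desc, hy]
      exact iff_of_false (fun hc => hvx hc.to_reflTransGen) fun hc => hux hc.to_reflTransGen
    · simp only [next', ρn _ hxv, hy]
      exact iff_of_false (fun hc => foll_rank x.1 j (by omega) hjd (by omega) (.single hc))
        fun hc => foll_rank x.1 i (by omega) (by omega) hx (.single hc)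
    · rw [foll, hy]
      exact iff_of_false (foll_rank x.1 j (by omega) hjd (by omega))
        (foll_rank x.1 i (by omega) (by omega) hx)
  · have hn : ∀ x y : {x // keep x}, ¬ (rank x.1 < i ∧ y.1 = c j) →
        (next' x y ↔ next x.1 y.1) := by
      intro x y hxy
      by_cases hy : y.1 = c j
      · have hx : j ≤ rank x.1 := by
          have h1 := x.2
          have h2 : ¬ rank x.1 < i := fun hc => hxy ⟨hc, hy⟩
          simp only [keep] at h1
          omega
        simp only [next', hy, ρv (c j) rfl]
        exact iff_of_false
          (fun hc => foll_rank' x.1 i (by omega) (by omega) (by omega) (.single hc))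
          fun hc => foll_rank' x.1 j (by omega) hjd hx (.single hc)
      · simp only [next', ρn _ hy]
    intro x y h1 h2
    exact relPos_congr ⟨Subtype.ext_iff, Iff.rfl, desc _ _, hn x y h1, foll _ _⟩
      ⟨Subtype.ext_iff, Iff.rfl, desc _ _, hn y x h2, foll _ _⟩

end RightSpine

end IsOrderedTree

/-! ### Smallest models obey the bound. -/

section Models

universe u v

variable {U : Type u} {C : Type v}

/-- Reconciles the surgery, which gives `v` the position of `u` relative to all ranks below `i`,
with `basePair`, which does so for rank `i - 1` only; on lower ranks both positions agree by
`habove`. -/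
theorem relPos_basePair {V V' : Type} {child next : V → V → Prop}
    {child' next' : V' → V' → Prop} (h : IsOrderedTree child next)
    (h' : IsOrderedTree child' next') (e : V' → V) {rank : V → ℕ} {i j : ℕ} {u v : V}
    (hij : i < j) (hv : rank v = j)
    (habove : ∀ x, rank x + 1 < i → relPos child next x u = relPos child next x v)
    (h1 : ∀ x y, rank (e x) < i → e y = v →
      relPos child' next' x y = relPos child next (e x) u)
    (h2 : ∀ x y, ¬ (rank (e x) < i ∧ e y = v) → ¬ (rank (e y) < i ∧ e x = v) →
      relPos child' next' x y = relPos child next (e x) (e y)) (x y : V') :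
    relPos child next (basePair rank i u v (e x) (e y)).1 (basePair rank i u v (e x) (e y)).2 =
      relPos child' next' x y := by
  have key : ∀ x y, rank (e x) < i → e y = v → relPos child next
      (basePair rank i u v (e x) (e y)).1 (basePair rank i u v (e x) (e y)).2 =
        relPos child' next' x y := by
    intro x y hx hy
    rw [h1 x y hx hy, basePair]
    by_cases hx1 : rank (e x) + 1 = i
    · rw [if_pos ⟨hx1, hy⟩]
    · rw [if_neg (fun hc => hx1 hc.1), if_neg, habove (e x) (by omega), hy]
      rintro ⟨-, hc⟩
      rw [hc, hv] at hx
      omega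
  have hswap : ∀ x y, basePair rank i u v (e y) (e x) = (basePair rank i u v (e x) (e y)).swap :=
    fun x y => basePair_swap (by omega) _ _
  by_cases hA : rank (e x) < i ∧ e y = v
  · exact key x y hA.1 hA.2
  by_cases hB : rank (e y) < i ∧ e x = v
  · rw [h'.relPos_flip y x, ← key y x hB.1 hB.2, hswap y x, ← h.relPos_flip]
    rfl
  rw [h2 x y hA hB, basePair, if_neg, if_neg]
  · exact fun hc => hB ⟨by omega, hc.2⟩
  · exact fun hc => hA ⟨by omega, hc.2⟩

/-- A model with a spine that is longer than the bound is not a smallest one. -/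
theorem NormalForm.exists_smaller_model (φ : NormalForm U C) (hm : 0 < φ.m)
    (T : TreeStructure U C) (hT : Sentence.Realize T.Carrier φ.toSentence) {d : ℕ}
    {c : ℕ → T.Carrier} {rank : T.Carrier → ℕ} (hs : IsSpine (relPos T.child T.next) d c rank)
    (hd : φ.bound < d)
    (hcontract : ∀ i j, 2 ≤ i → i < j → j ≤ d →
      ∃ child' next' : {x // ¬ (i ≤ rank x ∧ rank x < j)} →
          {x // ¬ (i ≤ rank x ∧ rank x < j)} → Prop,
        IsOrderedTree child' next' ∧
        (∀ x y, rank x.1 < i → y.1 = c j →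
          relPos child' next' x y = relPos T.child T.next x.1 (c i)) ∧
        ∀ x y, ¬ (rank x.1 < i ∧ y.1 = c j) → ¬ (rank y.1 < i ∧ x.1 = c j) →
          relPos child' next' x y = relPos T.child T.next x.1 y.1) :
    ∃ T' : TreeStructure U C, Nat.card T'.Carrier < Nat.card T.Carrier ∧
      Sentence.Realize T'.Carrier φ.toSentence := by
  classical
  have := T.finite
  have := Fintype.ofFinite T.Carrier
  have := (oneTypes_finite φ.toSentence).fintype
  have htree := T.isTree
  have hT' := (φ.realize_toSentence T).1 hT
  let tp : T.Carrier → oneTypes φ.toSentence := fun a =>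
    ⟨nodeType φ.toSentence T a, nodeType_mem_oneTypes _ T a⟩
  let conj : Fin φ.m → Conjunct U C := fun k => φ.conjuncts.get k
  have hguard : ∀ k a b, tp a = tp b → T.unary (conj k).guard a → T.unary (conj k).guard b := by
    intro k a b hab ha
    have hs := φ.guard_mem_symbols (φ.conjuncts.get_mem k)
    have h1 := (loopAtom_mem_nodeType (T := T) (a := a) hs).2 ha
    rw [show nodeType φ.toSentence T a = nodeType φ.toSentence T b from Subtype.ext_iff.1 hab] at h1
    exact (loopAtom_mem_nodeType (T := T) (a := b) hs).1 h1
  have hex : ∀ k x, ∃ y, (T.unary (conj k).guard x →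
      (conj k).position.Holds T.child T.next x y ∧
        (conj k).matrix.Realize (default : Empty → T.Carrier) ![x, y]) ∧
      -- The default witness `x` makes the position of the chosen witness a function of the type of
      -- `x` even where the guard fails.
      (¬ T.unary (conj k).guard x → y = x) := by
    intro k x
    by_cases hx : T.unary (conj k).guard x
    · obtain ⟨y, hy⟩ := hT'.2 _ (φ.conjuncts.get_mem k) x hx
      exact ⟨y, fun _ => hy, fun hc => absurd hx hc⟩
    · exact ⟨x, fun hc => absurd hc hx, fun _ => rfl⟩
  choose w hw1 hw2 using hex
  have hw : ∀ k a b, tp a = tp b →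
      relPos T.child T.next a (w k a) = relPos T.child T.next b (w k b) := by
    intro k a b hab
    by_cases ha : T.unary (conj k).guard a
    · rw [htree.holds_iff.1 (hw1 k a ha).1, htree.holds_iff.1 (hw1 k b (hguard k a b hab ha)).1]
    · rw [hw2 k a ha, hw2 k b fun hb => ha (hguard k b a hab.symm hb)]
      rw [IsOrderedTree.relPos_self, IsOrderedTree.relPos_self]
  obtain ⟨i, j, hi, hij, hjd, π, htp, hswap, hdiag, htype, hpos, hwit⟩ :=
    hs.exists_contraction tp w OrderFormula.flip (fun x y => htree.relPos_flip x y) hw hm (by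
      rw [← Nat.card_eq_fintype_card]
      exact hd)
  obtain ⟨child', next', htree', h1, h2⟩ := hcontract i j hi hij hjd
  have hru := hs.rank_spine i (by omega) (by omega)
  have hrv := hs.rank_spine j (by omega) hjd
  have habove : ∀ x, rank x + 1 < i →
      relPos T.child T.next x (c i) = relPos T.child T.next x (c j) := by
    intro x hx
    have hne : ∀ l, i ≤ l → l ≤ d → c l ≠ c (rank x + 1) := by
      intro l hil hld e
      have h1 := hs.rank_spine l (by omega) hld
      rw [e, hs.rank_spine (rank x + 1) (by omega) (by omega)] at h1
      omega
    refine hs.pos_above x _ _ (by omega) (by omega) (hne i le_rfl (by omega))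
      (hne j hij.le hjd) ?_
    rw [hru, hrv]
    exact iff_of_true rfl rfl
  have hsurg : ∀ x y : {x // ¬ (i ≤ rank x ∧ rank x < j)},
      relPos T.child T.next (π x y).1 (π x y).2 = relPos child' next' x y := fun x y =>
    (hpos x y).trans
      (relPos_basePair htree htree' Subtype.val hij hrv habove h1 h2 x y)
  have hholds : ∀ k a, T.unary (conj k).guard a →
      (conj k).position.Holds T.child T.next a (w k a) ∧
        (conj k).matrix.Realize (default : Empty → T.Carrier) ![a, w k a] := hw1
  obtain ⟨T', hT'V, hT'φ⟩ := φ.exists_model T hT htree' Subtype.val (fun x y => π x y)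
    (fun x y => hswap x y) (fun x => hdiag x)
    (fun x y => Subtype.ext_iff.1 (htype x y)) hsurg (by
      intro cj hcj x hx
      obtain ⟨k, rfl⟩ := List.mem_iff_get.1 hcj
      obtain ⟨y, hy, hy'⟩ := hwit x x.2 k
      refine ⟨⟨y, hy⟩, ?_⟩
      rcases hy' with e | ⟨hxv, e⟩
      · rw [e]
        exact hholds k x hx
      · rw [e]
        refine hholds k (c i) (hguard k x (c i) ?_ hx)
        rw [hxv, htp])
  refine ⟨T', ?_, hT'φ⟩
  rw [hT'V]
  refine Finite.card_subtype_lt (x := c i) ?_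
  rw [not_not]
  omega

/-- In a smallest model, paths are not longer than the bound. -/
theorem NormalForm.length_le_of_smallest (φ : NormalForm U C) (hm : 0 < φ.m)
    (T : TreeStructure U C) (hT : Sentence.Realize T.Carrier φ.toSentence)
    (hmin : ∀ T' : TreeStructure U C, Sentence.Realize T'.Carrier φ.toSentence →
      Nat.card T.Carrier ≤ Nat.card T'.Carrier) (P : List T.Carrier) (hP : T.IsDownPath P) :
    P.length ≤ φ.bound := by
  by_contra! hlt
  have h := T.isTree
  have hne : 0 < P.length := by omega
  set d := P.length with hd
  -- Spines are indexed from `1`, lists from `0`; the last value is a dummy.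
  let c : ℕ → T.Carrier := fun l => if hl : l - 1 < P.length then P[l - 1] else P[0]
  have hc : ∀ l, 1 ≤ l → l < d → T.child (c l) (c (l + 1)) := by
    intro l hl hld
    have h1 := List.isChain_iff_getElem.1 hP (l - 1) (by omega)
    simp only [c]
    rw [dif_pos (by omega), dif_pos (by omega)]
    simpa only [show l - 1 + 1 = l + 1 - 1 by omega] using h1
  obtain ⟨rank, hrd, hrank⟩ := IsOrderedTree.exists_down_rank hc
  obtain ⟨T', hlt', hT'⟩ := φ.exists_smaller_model hm T hT
    (h.isSpine_down hc hrank hrd) hlt (by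
      intro i j hi hij hjd
      obtain ⟨child', next', h1, h2, h3⟩ := h.exists_replace_subtree (u := c i) (v := c j)
        (IsOrderedTree.desc_spine hc (by omega) hij hjd)
        ⟨c (i - 1), by
          have := hc (i - 1) (by omega) (by omega)
          rwa [show i - 1 + 1 = i by omega] at this⟩
        (fun x => ¬ (i ≤ rank x ∧ rank x < j)) (fun x => by
          rw [← hrank x i (by omega) (by omega), ← hrank x j (by omega) hjd, not_le])
      simp only [← hrank _ i (by omega : 1 ≤ i) (by omega), not_le] at h2 h3
      exact ⟨child', next', h1, h2, h3⟩)
  exact absurd (hmin T' hT') (by omega)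

/-- In a smallest model, the degrees do not exceed the bound. -/
theorem NormalForm.degree_le_of_smallest (φ : NormalForm U C) (hm : 0 < φ.m)
    (T : TreeStructure U C) (hT : Sentence.Realize T.Carrier φ.toSentence)
    (hmin : ∀ T' : TreeStructure U C, Sentence.Realize T'.Carrier φ.toSentence →
      Nat.card T.Carrier ≤ Nat.card T'.Carrier) (a : T.Carrier) : T.degree a ≤ φ.bound := by
  by_contra! hlt
  have h := T.isTree
  have := T.finite
  obtain ⟨c, hchild, hnext⟩ := h.exists_enum_children a
  obtain ⟨rank, hrd, hrank⟩ := h.exists_right_rank hchild hnext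
  obtain ⟨T', hlt', hT'⟩ := φ.exists_smaller_model hm T hT
    (h.isSpine_right hchild hrank hrd hnext) hlt
    fun i j hi hij hjd => h.exists_remove_siblings hchild hrank hrd hnext hi hij hjd
  exact absurd (hmin T' hT') (by omega)

/-- The tree with a single node. -/
theorem isOrderedTree_unit : IsOrderedTree (fun _ _ : Unit => False) (fun _ _ : Unit => False) := by
  have hf : ∀ a b : Unit, ¬ TransGen (fun _ _ : Unit => False) a b := by
    intro a b hab
    obtain ⟨_, _, hc⟩ := TransGen.tail'_iff.1 hab
    exact hc
  exact ⟨⟨(), fun _ => id, fun _ => .refl⟩, fun _ _ _ hc => hc.elim, fun _ _ hc => hc.elim,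
    fun _ _ _ hc => hc.elim, fun a => hf a a, fun _ _ _ hc => hc.elim⟩

/-- Without `∀∃`-conjuncts, a single node of a model is a model. -/
theorem NormalForm.exists_unit_model (φ : NormalForm U C) (hm : φ.m = 0) (T : TreeStructure U C)
    (hT : Sentence.Realize T.Carrier φ.toSentence) :
    ∃ T' : TreeStructure U C, T'.Carrier = Unit ∧ Sentence.Realize T'.Carrier φ.toSentence := by
  obtain ⟨r, -⟩ := T.isTree.exists_root
  refine φ.exists_model T hT isOrderedTree_unit (fun _ => r) (fun _ _ => (r, r)) (fun _ _ => rfl)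
    (fun _ => rfl) (fun _ _ => rfl) (fun x y => ?_) fun c hc => ?_
  · rw [Subsingleton.elim x y, IsOrderedTree.relPos_self, IsOrderedTree.relPos_self]
  · rw [List.length_eq_zero_iff.1 hm] at hc
    simp at hc

/-- Minimality in the number of nodes gives both bounds for the same tree. For `m = 0` the bound is
`0`, which a one-node tree meets for degrees but no tree meets for path lengths. -/
theorem NormalForm.exists_bounded_model (φ : NormalForm U C) (hφ : Satisfiable φ.toSentence) :
    ∃ T : TreeStructure U C, Sentence.Realize T.Carrier φ.toSentence ∧
      (0 < φ.m → ∀ P : List T.Carrier, T.IsDownPath P → P.length ≤ φ.bound) ∧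
      ∀ a : T.Carrier, T.degree a ≤ φ.bound := by
  classical
  rcases Nat.eq_zero_or_pos φ.m with hm | hm
  · obtain ⟨T, hT⟩ := hφ
    obtain ⟨T', hT', hφ'⟩ := φ.exists_unit_model hm T hT
    refine ⟨T', hφ', fun h => by omega, fun a => ?_⟩
    have hsub : Subsingleton T'.Carrier := by rw [hT']; infer_instance
    have : {b | T'.child a b} = ∅ := by
      ext b
      refine iff_of_false (fun hb => T'.isTree.desc_irrefl a (.single ?_)) (Set.notMem_empty b)
      rwa [Subsingleton.elim b a] at hb
    simp [TreeStructure.degree, this]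
  · have hex : ∃ n, ∃ T : TreeStructure U C, Nat.card T.Carrier = n ∧
        Sentence.Realize T.Carrier φ.toSentence :=
      let ⟨T, hT⟩ := hφ
      ⟨_, T, rfl, hT⟩
    obtain ⟨T, hn, hT⟩ := Nat.find_spec hex
    have hmin : ∀ T' : TreeStructure U C, Sentence.Realize T'.Carrier φ.toSentence →
        Nat.card T.Carrier ≤ Nat.card T'.Carrier := fun T' hT' =>
      hn ▸ Nat.find_min' hex ⟨T', rfl, hT'⟩
    exact ⟨T, hT, fun _ => φ.length_le_of_smallest hm T hT hmin,
      φ.degree_le_of_smallest hm T hT hmin⟩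

end Models

end TreeFO2

theorem theorem2 :
    (∃ c : ℕ, ∀ (U : Type*) (C : Type*) (φ : TreeFO2.NormalForm U C),
      φ.bound ≤ 2 ^ (c * TreeFO2.size φ.toSentence)) ∧
    ∀ (U : Type*) (C : Type*) (φ : TreeFO2.NormalForm U C),
      TreeFO2.Satisfiable φ.toSentence →
        ∃ T : TreeFO2.TreeStructure U C,
          FirstOrder.Language.Sentence.Realize T.Carrier φ.toSentence ∧
          (0 < φ.m → ∀ P : List T.Carrier, T.IsDownPath P → P.length ≤ φ.bound) ∧
          (∀ a : T.Carrier, T.degree a ≤ φ.bound) :=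
  ⟨⟨13, fun _ _ φ => φ.bound_le⟩, fun _ _ φ hφ => φ.exists_bounded_model hφ⟩
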